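/- **Definitions.** A parity game with $n$ vertices, $m$ edges and $d$ priorities ($d$ even) is a directed graph $(V,E)$ with $|V|=n$, $|E|=m$, in which every vertex has an outgoing edge, together with a partition $V=V_E\uplus V_A$ into vertices of Eve and of Adam and a priority in $\{1,\dots,d\}$ for each vertex. The owner of the current vertex picks an outgoing edge (a strategy may depend on the whole path so far). Eve wins from $v$ if she has a strategy such that, against every strategy of Adam, the largest priority appearing infinitely often in the play from $v$ is even. All trees are finite and ordered (the children of each node are totally ordered, from left to right) and all leaves of a tree of height $h$ have depth exactly $h$. A tree $t$ embeds into $T$ if $t$ can be obtained from $T$ by removing nodes, the root being mapped to the root. $T$ is $(n,h)$-universal if it has height $h$ and all trees of height $h$ with at most $n$ leaves embed into $T$. $L(T)$ is the set of leaves and $|T|$ their number. Let $T$ have height $d/2$, and index its levels from the children of the root down to the leaves by the odd priorities $d-1,\dots,3,1$; for even $p<d$, level $p$ means level $p+1$, and level $d$ is the root. For $x,y\in L(T)\cup\{\top\}$ and $p\in[1,d]$, write $x\ge_p y$ if $x=\top$, or if both are leaves and the ancestor of $x$ at level $p$ is equal to or to the left of that of $y$; write $x>_p y$ if $x \ge_p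 y$ and not $y\ge_p x$, and, by convention, also $\top>_p\top$. So $\top$ is the largest element, and leaves are totally ordered by $\ge_1$, the rightmost leaf $\ell_{\min}$ being the smallest. For $\mu:V\to L(T)\cup\{\top\}$ and $v\in V$ of priority $p$, say that $x$ is good for $(\mu,v)$ if $x\ge_p\mu(v')$, and $x>_p\mu(v')$ when $p$ is odd, for some edge $(v,v')\in E$ if $v\in V_E$, and for all edges $(v,v')\in E$ if $v\in V_A$. Then $\mu$ is a *signature* if $\mu(v)$ is good for $(\mu,v)$ for all $v\in V$. Let $\mathrm{Lift}_v(\mu)$ be the smallest leaf (with respect to $\ge_1$) that is good for $(\mu,v)$, and $\top$ if there is none. The *generic value iteration algorithm over $T$* starts with $\mu(v)=\ell_{\min}$ for all $v$; while there is a $v$ with $\mu(v)\ne\mathrm{Lift}_v(\mu)$, it chooses such a $v$ and sets $\mu(v)\leftarrow\mathrm{Lift}_v(\mu)$; then it returns $\mu$. Running time is the number of steps of a unit-cost random access machine with registers and arrays of natural numbers, whose instructions are: constants, copy, increment, decrement, least significant bit, indexed (base + offset) load, store, and comparison-controlled branching and loops. The game is given by owners, priorities and adjacency lists (successors and predecessors).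 The tree $T$ is a parameter: its leaves are numbered from right to left, $\top$ gets the number $|T|$, and tables give for each leaf and each priority $p$ the interval of leaves below its ancestor at level $p$. A program *implements* the algorithm if its $\mu$-array initially represents the constant function $\ell_{\min}$, thereafter changes only by iterations of the loop of the algorithm, and when the program halts represents a $\mu$ at which the loop stops, which is its output. **Theorem.** For all $n,d\in\mathbb N$ with $d$ even, all $(n,d/2)$-universal trees $T$ and all parity games with $n$ vertices, $m$ edges and $d$ priorities, the following hold. 1. Whatever choices are made, the generic value iteration algorithm over $T$ stops after at most $n|T|$ iterations, and its output $\mu$ does not depend on the choices. 2. The output $\mu$ is a signature, and for all $v\in V$, $\mu(v)\neq\top$ if and only if Eve wins from $v$. 3. The algorithm runs in time $O(m\log(n)\log(d)\cdot|T|)$. That is, there are one program and one constant $C$, independent of $n$, $d$, $T$ and the game, such that whenever $n\ge1$ the program implements the algorithm, outputs $\mu$, and halts after at most $C\cdot m\cdot\max(1,\log_2 n)\cdot\log_2 d\cdot|T|$ steps. -/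

import Mathlib

namespace ParityVI

/-! ### Parity games -/

/-- A parity game with vertex set `Fin n` and priorities in `{1, …, d}`: a directed graph in which
every vertex has an outgoing edge, a partition of the vertices between Eve and Adam (the vertices
outside `eve` are Adam's), and a priority for each vertex. -/
structure ParityGame (n d : ℕ) where
  edges : Finset (Fin n × Fin n)
  eve : Finset (Fin n)
  prio : Fin n → ℕ
  total : ∀ v, ∃ w, (v, w) ∈ edges
  prio_pos : ∀ v, 1 ≤ prio v
  prio_le : ∀ v, prio v ≤ d

namespace ParityGame

variable {n d : ℕ}

/-- A strategy (for either player) chooses an outgoing edge for every nonempty path, given as the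
list of the vertices visited before the current one, and the current vertex. -/
def Strategy (G : ParityGame n d) : Type :=
  {σ : List (Fin n) → Fin n → Fin n // ∀ hist v, (v, σ hist v) ∈ G.edges}

/-- Past vertices and current vertex after `i` moves of the unique play from `v₀` consistent with
the strategy `σ` for Eve and the strategy `τ` for Adam. -/
def position (G : ParityGame n d) (σ τ : G.Strategy) (v₀ : Fin n) : ℕ → List (Fin n) × Fin n
  | 0 => ([], v₀)
  | i + 1 =>
    let h := (G.position σ τ v₀ i).1
    let v := (G.position σ τ v₀ i).2
    (h ++ [v], if v ∈ G.eve then σ.1 h v else τ.1 h v)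

/-- The play from `v₀` consistent with `σ` and `τ`. -/
def play (G : ParityGame n d) (σ τ : G.Strategy) (v₀ : Fin n) (i : ℕ) : Fin n :=
  (G.position σ τ v₀ i).2

/-- The parity objective: the largest priority appearing infinitely often is even. -/
def Parity (G : ParityGame n d) (π : ℕ → Fin n) : Prop :=
  ∃ p, Even p ∧ (∃ᶠ i in Filter.atTop, G.prio (π i) = p) ∧
    ∀ q, (∃ᶠ i in Filter.atTop, G.prio (π i) = q) → q ≤ p

/-- Eve wins from `v`: she has a strategy that is winning from `v` against all strategies of
Adam. -/
def EveWins (G : ParityGame n d) (v : Fin n) : Prop :=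
  ∃ σ : G.Strategy, ∀ τ : G.Strategy, G.Parity (G.play σ τ v)

end ParityGame

/-! ### Ordered trees and universal trees -/

/-- Finite ordered trees all of whose leaves have depth exactly `h`. The children of a node are
listed from left to right. -/
inductive OrdTree : ℕ → Type
  | leaf : OrdTree 0
  | node {h : ℕ} (k : ℕ) (child : Fin (k + 1) → OrdTree h) : OrdTree (h + 1)

namespace OrdTree

/-- The leaves of a tree, from left to right. A leaf is given by its branch, i.e. the list of the
child indices met on the way from the root. Hence the ancestor of a leaf `x` at depth `k` is
`x.take k`, and "to the left of" is the lexicographic order. -/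
def leaves : {h : ℕ} → OrdTree h → List (List ℕ)
  | _, leaf => [[]]
  | _, node k child =>
    (List.finRange (k + 1)).flatMap fun i => (child i).leaves.map fun x => (i : ℕ) :: x

/-- The size `|T|`: the number of leaves. -/
def size {h : ℕ} (T : OrdTree h) : ℕ := T.leaves.length

/-- `t.Embeds T`: the ordered tree `t` can be obtained from `T` by removing nodes, the root being
mapped to the root. -/
def Embeds : {h : ℕ} → OrdTree h → OrdTree h → Prop
  | _, leaf, leaf => True
  | _, node _ c, node _ c' => ∃ f, StrictMono f ∧ ∀ i, (c i).Embeds (c' (f i))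

/-- `T` is `(n, h)`-universal: all trees of height `h` with at most `n` leaves embed into `T`. -/
def IsUniversal {h : ℕ} (n : ℕ) (T : OrdTree h) : Prop :=
  ∀ t : OrdTree h, t.size ≤ n → t.Embeds T

/-- The set `L(T)` of leaves. -/
abbrev Leaf {h : ℕ} (T : OrdTree h) : Type := {x : List ℕ // x ∈ T.leaves}

/-- `L(T) ∪ {⊤}`. Leaves are ordered from right (smallest) to left (largest). -/
abbrev Value {h : ℕ} (T : OrdTree h) : Type := WithTop (T.Leaf)ᵒᵈ

noncomputable instance {h : ℕ} (T : OrdTree h) : Fintype T.Leaf := Fintype.ofFinite _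

/-- The ancestor at depth `k` of a leaf, and `⊤` for `⊤`; nodes of depth `k` are ordered from right
(smallest) to left (largest), and `⊤` is the largest element. -/
def ancestor {h : ℕ} (T : OrdTree h) (k : ℕ) : T.Value → WithTop (List ℕ)ᵒᵈ :=
  WithTop.map fun x => OrderDual.toDual ((OrderDual.ofDual x).1.take k)

end OrdTree

/-- The depth of the nodes at level `p` in a tree of height `d / 2` whose levels are indexed from
the children of the root down to the leaves by the odd priorities `d - 1, …, 3, 1`; an even `p`
stands for the level of `p + 1`, the even `p = d` for the root. -/
def levelDepth (d p : ℕ) : ℕ := (d + 1 - p) / 2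

/-! ### Signatures and the generic value iteration algorithm -/

section ValueIteration

variable {n d : ℕ} (G : ParityGame n d) (T : OrdTree (d / 2))

/-- The comparison required at a vertex of priority `p`: `x ≥_p y`, and `x >_p y` if `p` is odd,
with the convention `⊤ >_p ⊤`. -/
def Progress (p : ℕ) (x y : T.Value) : Prop :=
  if Odd p then T.ancestor (levelDepth d p) y < T.ancestor (levelDepth d p) x ∨ x = ⊤
  else T.ancestor (levelDepth d p) y ≤ T.ancestor (levelDepth d p) x

/-- The value `x` satisfies the signature condition at the vertex `v` with respect to `μ`. -/
def LocalCond (μ : Fin n → T.Value) (v : Fin n) (x : T.Value) : Prop :=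
  if v ∈ G.eve then ∃ w, (v, w) ∈ G.edges ∧ Progress T (G.prio v) x (μ w)
  else ∀ w, (v, w) ∈ G.edges → Progress T (G.prio v) x (μ w)

/-- Signatures `V → L(T) ∪ {⊤}`. -/
def IsSignature (μ : Fin n → T.Value) : Prop :=
  ∀ v, LocalCond G T μ v (μ v)

open Classical in
/-- `Lift_v(μ)`: the smallest leaf satisfying the signature condition at `v` with respect to `μ`,
and `⊤` if there is none. -/
noncomputable def lift (μ : Fin n → T.Value) (v : Fin n) : T.Value :=
  {ℓ : (T.Leaf)ᵒᵈ | LocalCond G T μ v (ℓ : T.Value)}.toFinset.inf fun ℓ => (ℓ : T.Value)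

/-- The smallest leaf `ℓ_min`, i.e. the rightmost one. (Every tree has a leaf, so that the value
is never `⊤`.) -/
noncomputable def leafMin : T.Value :=
  (Finset.univ : Finset (T.Leaf)ᵒᵈ).inf fun ℓ => (ℓ : T.Value)

/-- One iteration of the loop: some `v` with `μ(v) ≠ Lift_v(μ)` is chosen and lifted. -/
def LoopStep (μ μ' : Fin n → T.Value) : Prop :=
  ∃ v, μ v ≠ lift G T μ v ∧ μ' = Function.update μ v (lift G T μ v)

/-- `μ` can be returned by the generic value iteration algorithm over `T`: starting from the
constant function `ℓ_min`, loop iterations lead to `μ`, where the algorithm stops. -/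
def IsOutput (μ : Fin n → T.Value) : Prop :=
  Relation.ReflTransGen (LoopStep G T) (fun _ => leafMin T) μ ∧ ∀ v, μ v = lift G T μ v

end ValueIteration

/-! ### The machine model -/

/-- Instructions of a unit-cost random access machine with registers `r₀, r₁, …` and arrays
`A₀, A₁, …`, all holding natural numbers. The only arithmetic on contents is increment, decrement
and reading off the least significant bit, so contents grow by at most one per step beyond the input
and the constants of the program. -/
inductive Instr : Type
  /-- `r_x := k` -/
  | const (x k : ℕ)
  /-- `r_x := r_y` -/
  | copy (x y : ℕ)
  /-- `r_x := r_x + 1` -/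
  | inc (x : ℕ)
  /-- `r_x := r_x - 1` (truncated) -/
  | dec (x : ℕ)
  /-- `r_x := r_y mod 2` -/
  | bit (x y : ℕ)
  /-- `r_x := A_a[r_y]` -/
  | load (x a y : ℕ)
  /-- `r_x := A_a[r_y + r_z]` -/
  | loadOff (x a y z : ℕ)
  /-- `A_a[r_y] := r_x` -/
  | store (a y x : ℕ)
  /-- `if r_x < r_y then P else Q` -/
  | ite (x y : ℕ) (P Q : List Instr)
  /-- `while r_x < r_y do P` -/
  | loop (x y : ℕ) (P : List Instr)

/-- A program is a finite sequence of instructions. -/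
abbrev Program : Type := List Instr

/-- A configuration: the code that remains to be executed, the registers and the arrays. -/
structure Config where
  code : Program
  reg : ℕ → ℕ
  arr : ℕ → ℕ → ℕ

/-- One step of the machine; a test counts as a step. The machine has halted when no code is
left. -/
def Config.step (s : Config) : Config :=
  match s.code with
  | [] => s
  | .const x k :: K => ⟨K, Function.update s.reg x k, s.arr⟩
  | .copy x y :: K => ⟨K, Function.update s.reg x (s.reg y), s.arr⟩
  | .inc x :: K => ⟨K, Function.update s.reg x (s.reg x + 1), s.arr⟩
  | .dec x :: K => ⟨K, Function.update s.reg x (s.reg x - 1), s.arr⟩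
  | .bit x y :: K => ⟨K, Function.update s.reg x (s.reg y % 2), s.arr⟩
  | .load x a y :: K => ⟨K, Function.update s.reg x (s.arr a (s.reg y)), s.arr⟩
  | .loadOff x a y z :: K => ⟨K, Function.update s.reg x (s.arr a (s.reg y + s.reg z)), s.arr⟩
  | .store a y x :: K =>
    ⟨K, s.reg, Function.update s.arr a (Function.update (s.arr a) (s.reg y) (s.reg x))⟩
  | .ite x y P Q :: K => ⟨(if s.reg x < s.reg y then P else Q) ++ K, s.reg, s.arr⟩
  | .loop x y P :: K =>
    ⟨if s.reg x < s.reg y then P ++ .loop x y P :: K else K, s.reg, s.arr⟩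

/-- The configuration after `i` steps. -/
def Config.after (s : Config) (i : ℕ) : Config := Config.step^[i] s

/-! ### Input and output conventions -/

namespace OrdTree

variable {h : ℕ} (T : OrdTree h)

/-- The leaves from right to left, that is, in increasing order. -/
def ascLeaves : List (List ℕ) := T.leaves.reverse

/-- The number that stands for a value in the machine: leaves are numbered `0, …, |T| - 1` from
right to left, and `⊤` is `|T|`. -/
def code (x : T.Value) : ℕ :=
  match x with
  | none => T.size
  | some ℓ => T.ascLeaves.idxOf (OrderDual.ofDual ℓ).1

/-- The test whether a leaf has the same ancestor at depth `k` as the leaf with number `i`. -/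
def sameAncestor (k i : ℕ) (x : List ℕ) : Bool :=
  x.take k == (T.ascLeaves.getD i []).take k

/-- The leaves below the ancestor at depth `k` of the leaf with number `i` have the numbers `j` with
`intervalStart k i ≤ j < intervalEnd k i`. -/
def intervalStart (k i : ℕ) : ℕ := T.ascLeaves.findIdx (T.sameAncestor k i)

/-- See `intervalStart`. -/
def intervalEnd (k i : ℕ) : ℕ := T.intervalStart k i + T.ascLeaves.countP (T.sameAncestor k i)

end OrdTree

namespace ParityGame

variable {n d : ℕ} (G : ParityGame n d)

/-- The successors of a vertex, in increasing order. -/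
def succs (v : Fin n) : List ℕ :=
  ((List.finRange n).filter fun w => (v, w) ∈ G.edges).map Fin.val

/-- The predecessors of a vertex, in increasing order. -/
def preds (v : Fin n) : List ℕ :=
  ((List.finRange n).filter fun u => (u, v) ∈ G.edges).map Fin.val

/-- Concatenation of the lists attached to the vertices. -/
def concat (f : Fin n → List ℕ) : List ℕ := (List.finRange n).flatMap f

/-- Position in `concat f` at which the list of the vertex `v` starts (for `v = n`, the total
length). -/
def startPos (f : Fin n → List ℕ) (v : ℕ) : ℕ :=
  (((List.finRange n).take v).map fun u => (f u).length).sum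

end ParityGame

/-- The array in which the machine keeps the function `μ`. -/
def muArray : ℕ := 10

/-- The initial contents of the arrays. The game is given by ownership, priorities and adjacency
lists (of successors and of predecessors); the tree, which is a parameter of the algorithm, is
available through two tables that give for each leaf and each priority `p` the interval of the
leaves below its ancestor at level `p`, the rows of the tables starting at the positions listed in
array `7`. All other cells are `0`. -/
def initArr {n d : ℕ} (G : ParityGame n d) (T : OrdTree (d / 2)) (a i : ℕ) : ℕ :=
  match a with
  | 0 => [n, G.edges.card, d, T.size].getD i 0
  | 1 => if hi : i < n then (if (⟨i, hi⟩ : Fin n) ∈ G.eve then 1 else 0) else 0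
  | 2 => if hi : i < n then G.prio ⟨i, hi⟩ else 0
  | 3 => if i ≤ n then ParityGame.startPos G.succs i else 0
  | 4 => (ParityGame.concat G.succs).getD i 0
  | 5 => if i ≤ n then ParityGame.startPos G.preds i else 0
  | 6 => (ParityGame.concat G.preds).getD i 0
  | 7 => if i ≤ d then i * T.size else 0
  | 8 => if i / T.size ≤ d then T.intervalStart (levelDepth d (i / T.size)) (i % T.size) else 0
  | 9 => if i / T.size ≤ d then T.intervalEnd (levelDepth d (i / T.size)) (i % T.size) else 0
  | _ => 0

/-- The initial configuration of the program `P` on the game `G` and the tree `T`. -/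
def initConfig {n d : ℕ} (P : Program) (G : ParityGame n d) (T : OrdTree (d / 2)) : Config :=
  ⟨P, fun _ => 0, initArr G T⟩

/-- Started on the game `G` and the tree `T`, the program `P` executes the generic value iteration
algorithm over `T`, halts after exactly `t` steps and returns `μ`: the contents of the `μ`-array
represent the constant function `ℓ_min` initially, change only by iterations of the loop of the
algorithm, and represent `μ`, where the loop ends, when the machine halts. -/
def ExecutesValueIteration {n d : ℕ} (P : Program) (G : ParityGame n d) (T : OrdTree (d / 2))
    (t : ℕ) (μ : Fin n → T.Value) : Prop :=
  (∀ i < t, ((initConfig P G T).after i).code ≠ []) ∧ ((initConfig P G T).after t).code = [] ∧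
  ∃ r : ℕ → Fin n → T.Value,
    r 0 = (fun _ => leafMin T) ∧
    (∀ i < t, r (i + 1) = r i ∨ LoopStep G T (r i) (r (i + 1))) ∧
    (∀ i ≤ t, ∀ v : Fin n, ((initConfig P G T).after i).arr muArray v.val = T.code (r i v)) ∧
    r t = μ ∧ ∀ v, μ v = lift G T μ v

end ParityVI

/-!
Value iteration over a universal tree solves parity games, in time `O(m |T|)` on the machine.

`Lift_v(μ)` is the least value that is good for `(μ, v)` (`lift_le_iff`) and is monotone in `μ`.
Starting from the smallest values, each iteration of the loop therefore raises `μ` (`LoopStep.le_lift`)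
and keeps it below every signature (`LoopStep.le_of_isSignature`), so that every output is the least
signature (`IsOutput.le`).

From a vertex with a value other than `⊤`, Eve wins by following edges along which the signature
makes progress: if the largest priority seen infinitely often were odd, the ancestors at its level
would eventually decrease forever (`IsSignature.eveWins`). Conversely, Zielonka's recursion,
carried out for ranks instead of strategies, covers every game by two regions, on each of which one
of the players has ranks that make progress (`exists_rankings`). Adam wins on his region, against
strategies of Eve with arbitrary memory, so every vertex from which Eve wins lies in her region. Her
ranks, one for each level and each refining the next, are the nodes of a tree with at most one leaf
for each vertex (`OrdTree.exists_of_ranks`); embedding this tree into the universal tree turns the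
ranks into a signature that is finite on her region, hence so is the least signature.

For the running time, the values are replaced by their numbers. The smallest number that makes
progress at an edge is the start or the end of the interval listed in the tables
(`progress_iff_threshold_le`), and a lift is a minimum or maximum of such thresholds. The program
keeps for each vertex a counter that vanishes exactly if the vertex has to be lifted, and a stack of
the vertices with vanishing counter. A lift of `v` scans the successors of `v`, updates the
counters of its predecessors at the edges that cease to be good (`credit_update`), and computes the
counter of `v` anew. This takes time proportional to the degree of `v` and happens at most `|T|`
times for each `v`. The correctness proof uses weakest preconditions that count steps (`WP`).
-/

namespace ParityVI

/-! ### Numbering the leaves -/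

/-- If `q` holds on an initial part of the list only, then counting finds the end of that part. -/
theorem countP_le_iff_of_pairwise {α : Type*} (q : α → Bool) (l : List α)
    (hl : l.Pairwise fun a b => q b → q a) {j : ℕ} (hj : j < l.length) :
    l.countP q ≤ j ↔ ¬ q l[j] := by
  induction l generalizing j with
  | nil => simp at hj
  | cons b l ih =>
    rw [List.pairwise_cons] at hl
    by_cases hb : q b
    · rw [List.countP_cons_of_pos hb]
      cases j with
      | zero => simp [hb]
      | succ j => simpa using ih hl.2 (by simpa using hj)
    · have h0 : l.countP q = 0 := by
        rw [List.countP_eq_zero]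
        exact fun a ha hqa => hb (hl.1 a ha hqa)
      rw [List.countP_cons_of_neg hb, h0]
      cases j with
      | zero => simp [hb]
      | succ j =>
        have := hl.1 (l[j]'(by simpa using hj)) (List.getElem_mem _)
        simp only [List.getElem_cons_succ, zero_le, true_iff]
        exact fun h => hb (this h)

theorem findIdx_beq_eq_countP {α : Type*} [LinearOrder α] [BEq α] [LawfulBEq α] (c : α)
    (q : α → Bool) (hq : ∀ a, q a ↔ c < a) (l : List α) (hl : l.Pairwise (· ≥ ·)) (hc : c ∈ l) :
    l.findIdx (· == c) = l.countP q := by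
  induction l with
  | nil => simp at hc
  | cons b l ih =>
    rw [List.pairwise_cons] at hl
    rw [List.findIdx_cons]
    by_cases hb : b = c
    · subst hb
      symm
      simpa [List.countP_cons, hq] using hl.1
    · have hcl : c ∈ l := by
        rcases List.mem_cons.1 hc with h | h
        · exact absurd h.symm hb
        · exact h
      have hlt : c < b := lt_of_le_of_ne (hl.1 c hcl) (Ne.symm hb)
      rw [List.countP_cons_of_pos ((hq b).2 hlt), ih hl.2 hcl, beq_eq_false_iff_ne.2 hb, cond_false]

theorem countP_lt_add_countP_beq {α : Type*} [LinearOrder α] [BEq α] [LawfulBEq α] (c : α)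
    (q r : α → Bool) (hq : ∀ a, q a ↔ c < a) (hr : ∀ a, r a ↔ c ≤ a) (l : List α) :
    l.countP q + l.countP (· == c) = l.countP r := by
  induction l with
  | nil => simp
  | cons b l ih =>
    simp only [List.countP_cons, ← ih, hq, hr, beq_iff_eq]
    rcases lt_trichotomy b c with h | h | h
    · simp [h.not_gt, h.ne, h.not_ge]
    · subst h; simp; omega
    · simp [h, h.ne', h.le]; omega

theorem findIdx_add_countP_le_length {α : Type*} (q : α → Bool) (l : List α) :
    l.findIdx q + l.countP q ≤ l.length := by
  induction l with
  | nil => simp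
  | cons c l ih =>
    rw [List.findIdx_cons, List.countP_cons, List.length_cons]
    have := List.countP_le_length (p := q) (l := l)
    cases q c <;> simp <;> omega

theorem take_le_take {x y : List ℕ} (h : x ≤ y) (k : ℕ) : x.take k ≤ y.take k := by
  induction k generalizing x y with
  | zero => simp
  | succ k ih =>
    rcases h.lt_or_eq with h | rfl
    swap
    · exact le_rfl
    cases x with
    | nil => exact not_lt.1 (List.not_lt_nil _)
    | cons a x =>
      cases y with
      | nil => exact absurd h (List.not_lt_nil _)
      | cons b y =>
        rw [List.take_succ_cons, List.take_succ_cons]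
        rcases List.cons_lt_cons_iff.1 h with h' | ⟨rfl, h'⟩
        · exact le_of_lt (List.cons_lt_cons_iff.2 (Or.inl h'))
        · exact List.cons_le_cons a (ih (le_of_lt h'))

namespace OrdTree

variable {h : ℕ} (T : OrdTree h)

theorem size_pos : 0 < T.size := by
  induction T with
  | leaf => simp [size, leaves]
  | node k child ih =>
    rw [size, List.length_pos_iff_exists_mem]
    obtain ⟨y, hy⟩ := List.length_pos_iff_exists_mem.1 (ih 0)
    exact ⟨0 :: y, by
      simp only [leaves, List.mem_flatMap, List.mem_map]
      exact ⟨0, List.mem_finRange _, y, hy, rfl⟩⟩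

theorem pairwise_leaves : T.leaves.Pairwise (· < ·) := by
  induction T with
  | leaf => simp [leaves]
  | node k child ih =>
    rw [leaves, List.pairwise_flatMap]
    refine ⟨fun i _ => ?_, ?_⟩
    · rw [List.pairwise_map]
      exact (ih i).imp fun h => List.cons_lt_cons_iff.2 (Or.inr ⟨rfl, h⟩)
    · refine (List.pairwise_lt_finRange (k + 1)).imp fun {i j} hij => ?_
      simp only [List.mem_map]
      rintro _ ⟨x, -, rfl⟩ _ ⟨y, -, rfl⟩
      exact List.cons_lt_cons_iff.2 (Or.inl hij)

theorem pairwise_ascLeaves : T.ascLeaves.Pairwise (· > ·) := by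
  rw [ascLeaves, List.pairwise_reverse]
  exact T.pairwise_leaves

theorem length_ascLeaves : T.ascLeaves.length = T.size := by simp [ascLeaves, size]

theorem mem_ascLeaves {x : List ℕ} : x ∈ T.ascLeaves ↔ x ∈ T.leaves := by simp [ascLeaves]

@[simp] theorem code_top : T.code ⊤ = T.size := rfl

theorem code_coe (ℓ : (T.Leaf)ᵒᵈ) :
    T.code (ℓ : T.Value) = T.ascLeaves.idxOf (OrderDual.ofDual ℓ).1 := rfl

theorem code_coe_lt (ℓ : (T.Leaf)ᵒᵈ) : T.code (ℓ : T.Value) < T.size := by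
  rw [code_coe, ← length_ascLeaves, List.idxOf_lt_length_iff, mem_ascLeaves]
  exact (OrderDual.ofDual ℓ).2

theorem code_le_size (x : T.Value) : T.code x ≤ T.size := by
  cases x using WithTop.recTopCoe with
  | top => exact le_rfl
  | coe ℓ => exact (T.code_coe_lt ℓ).le

theorem ascLeaves_code (ℓ : (T.Leaf)ᵒᵈ) :
    T.ascLeaves[T.code (ℓ : T.Value)]'(by rw [length_ascLeaves]; exact T.code_coe_lt ℓ) =
      (OrderDual.ofDual ℓ).1 := by
  simp [code_coe]

theorem code_strictMono : StrictMono T.code := by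
  intro x y hxy
  cases x using WithTop.recTopCoe with
  | top => simp at hxy
  | coe a =>
    cases y using WithTop.recTopCoe with
    | top => exact T.code_coe_lt a
    | coe b =>
      have hab : (OrderDual.ofDual b).1 < (OrderDual.ofDual a).1 := by
        exact (WithTop.coe_lt_coe.1 hxy : a < b)
      rw [← T.ascLeaves_code a, ← T.ascLeaves_code b] at hab
      by_contra hle
      rcases (not_lt.1 hle).lt_or_eq with h | h
      · exact lt_asymm hab ((List.pairwise_iff_getElem.1 T.pairwise_ascLeaves) _ _ _ _ h)
      · simp [h] at hab

theorem code_le_code {x y : T.Value} : T.code x ≤ T.code y ↔ x ≤ y :=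
  T.code_strictMono.le_iff_le

theorem code_injective : Function.Injective T.code := T.code_strictMono.injective

theorem code_eq_size {x : T.Value} : T.code x = T.size ↔ x = ⊤ := by
  rw [← code_top, T.code_injective.eq_iff]

theorem exists_code_eq {c : ℕ} (hc : c ≤ T.size) : ∃ x : T.Value, T.code x = c := by
  rcases hc.lt_or_eq with h | rfl
  · have h' : c < T.ascLeaves.length := by rwa [length_ascLeaves]
    refine ⟨((OrderDual.toDual ⟨T.ascLeaves[c], T.mem_ascLeaves.1 (List.getElem_mem h')⟩ :
      (T.Leaf)ᵒᵈ) : T.Value), ?_⟩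
    rw [code_coe]
    have hnd : T.ascLeaves.Nodup := T.pairwise_ascLeaves.imp fun h => ne_of_gt h
    exact hnd.idxOf_getElem c h'
  · exact ⟨⊤, T.code_top⟩

theorem pairwise_take_ascLeaves (k : ℕ) :
    (T.ascLeaves.map (List.take k)).Pairwise (· ≥ ·) := by
  rw [List.pairwise_map]
  exact T.pairwise_ascLeaves.imp fun h => take_le_take (le_of_lt h) k

theorem intervalStart_code_le_iff (k : ℕ) (a b : (T.Leaf)ᵒᵈ) :
    T.intervalStart k (T.code (b : T.Value)) ≤ T.code (a : T.Value) ↔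
      (OrderDual.ofDual a).1.take k ≤ (OrderDual.ofDual b).1.take k := by
  have hb : T.code (b : T.Value) < T.ascLeaves.length := by
    rw [length_ascLeaves]; exact T.code_coe_lt b
  have ha : T.code (a : T.Value) < (T.ascLeaves.map (List.take k)).length := by
    rw [List.length_map, length_ascLeaves]; exact T.code_coe_lt a
  set c := (OrderDual.ofDual b).1.take k with hc
  have hmem : c ∈ T.ascLeaves.map (List.take k) :=
    List.mem_map_of_mem (T.mem_ascLeaves.2 (OrderDual.ofDual b).2)
  have hs : T.intervalStart k (T.code (b : T.Value)) =
      (T.ascLeaves.map (List.take k)).countP fun a => decide (c < a) := by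
    rw [← findIdx_beq_eq_countP c (fun a => decide (c < a)) (by simp) _
      (T.pairwise_take_ascLeaves k) hmem, List.findIdx_map,
      intervalStart]
    congr 1
    funext x
    simp [sameAncestor, hb, T.ascLeaves_code b, hc]
  rw [hs, countP_le_iff_of_pairwise _ _ _ ha]
  · simp [T.ascLeaves_code a]
  · refine (T.pairwise_take_ascLeaves k).imp fun {x y} hxy => ?_
    simpa using fun h => lt_of_lt_of_le h hxy

theorem intervalEnd_code_le_iff (k : ℕ) (a b : (T.Leaf)ᵒᵈ) :
    T.intervalEnd k (T.code (b : T.Value)) ≤ T.code (a : T.Value) ↔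
      (OrderDual.ofDual a).1.take k < (OrderDual.ofDual b).1.take k := by
  have hb : T.code (b : T.Value) < T.ascLeaves.length := by
    rw [length_ascLeaves]; exact T.code_coe_lt b
  have ha : T.code (a : T.Value) < (T.ascLeaves.map (List.take k)).length := by
    rw [List.length_map, length_ascLeaves]; exact T.code_coe_lt a
  set c := (OrderDual.ofDual b).1.take k with hc
  have hmem : c ∈ T.ascLeaves.map (List.take k) :=
    List.mem_map_of_mem (T.mem_ascLeaves.2 (OrderDual.ofDual b).2)
  have hp : T.sameAncestor k (T.code (b : T.Value)) = (· == c) ∘ List.take k := by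
    funext x
    simp [sameAncestor, hb, T.ascLeaves_code b, hc]
  have hs : T.intervalEnd k (T.code (b : T.Value)) =
      (T.ascLeaves.map (List.take k)).countP fun a => decide (c ≤ a) := by
    rw [← countP_lt_add_countP_beq c (fun a => decide (c < a)) _ (by simp) (by simp),
      ← findIdx_beq_eq_countP c (fun a => decide (c < a)) (by simp) _
        (T.pairwise_take_ascLeaves k) hmem, List.findIdx_map,
      List.countP_map, intervalEnd, intervalStart, hp]
  rw [hs, countP_le_iff_of_pairwise _ _ _ ha]
  · simp [T.ascLeaves_code a]
  · refine (T.pairwise_take_ascLeaves k).imp fun {x y} hxy => ?_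
    simpa using fun h => le_trans h hxy

theorem intervalStart_le_size (k i : ℕ) : T.intervalStart k i ≤ T.size := by
  rw [← length_ascLeaves]; exact List.findIdx_le_length

end OrdTree

/-- The number of the smallest value `x` with `x ≥_p y` (`p` even) or `x >_p y` (`p` odd), in terms
of the number `c` of `y`. -/
def threshold {d : ℕ} (T : OrdTree (d / 2)) (p c : ℕ) : ℕ :=
  if c < T.size then
    if p % 2 = 1 then T.intervalEnd (levelDepth d p) c else T.intervalStart (levelDepth d p) c
  else T.size

theorem threshold_le_size {d : ℕ} (T : OrdTree (d / 2)) (p c : ℕ) :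
    threshold T p c ≤ T.size := by
  unfold threshold OrdTree.intervalEnd
  split_ifs
  · rw [← T.length_ascLeaves]
    exact findIdx_add_countP_le_length _ _
  · exact T.intervalStart_le_size _ _
  · exact le_rfl

theorem progress_iff_threshold_le {d : ℕ} (T : OrdTree (d / 2)) (p : ℕ) (x y : T.Value) :
    Progress T p x y ↔ threshold T p (T.code y) ≤ T.code x := by
  cases y using WithTop.recTopCoe with
  | top =>
    have hx : T.size ≤ T.code x ↔ x = ⊤ := by
      rw [← T.code_eq_size]; exact ⟨fun h => le_antisymm (T.code_le_size x) h, fun h => h.ge⟩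
    simp only [threshold, OrdTree.code_top, lt_irrefl, if_false, hx, Progress, OrdTree.ancestor,
      WithTop.map_top, not_top_lt, false_or, top_le_iff, WithTop.map_eq_top_iff, ite_self]
  | coe b =>
    have hb := T.code_coe_lt b
    cases x using WithTop.recTopCoe with
    | top =>
      simp [Progress, OrdTree.ancestor, threshold_le_size]
    | coe a =>
      unfold threshold Progress OrdTree.ancestor
      rw [if_pos hb]
      by_cases hp : Odd p
      · rw [if_pos hp, if_pos (Nat.odd_iff.1 hp), T.intervalEnd_code_le_iff]
        simp
      · rw [if_neg hp, if_neg (fun h => hp (Nat.odd_iff.2 h)), T.intervalStart_code_le_iff]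
        simp

/-! ### The lifting operator and its iteration -/

theorem ParityGame.mem_succs {n d : ℕ} (G : ParityGame n d) {v : Fin n} {k : ℕ} :
    k ∈ G.succs v ↔ ∃ w : Fin n, (v, w) ∈ G.edges ∧ w.val = k := by
  simp [ParityGame.succs]

theorem foldl_min_le_iff (l : List ℕ) (b x : ℕ) :
    l.foldl min b ≤ x ↔ b ≤ x ∨ ∃ y ∈ l, y ≤ x := by
  induction l generalizing b with
  | nil => simp
  | cons c l ih => simp [ih, or_assoc]

theorem foldl_max_le_iff (l : List ℕ) (b x : ℕ) :
    l.foldl max b ≤ x ↔ b ≤ x ∧ ∀ y ∈ l, y ≤ x := by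
  induction l generalizing b with
  | nil => simp
  | cons c l ih => simp [ih, and_assoc]

section Lifting

variable {n d : ℕ} (G : ParityGame n d) (T : OrdTree (d / 2))

/-- The array `a` holds the numbers of the values of `μ`. -/
def Represents (a : ℕ → ℕ) (μ : Fin n → T.Value) : Prop :=
  ∀ v : Fin n, a v = T.code (μ v)

/-- The number of `Lift_v(μ)`, in terms of the array `a` representing `μ`. -/
def liftCode (a : ℕ → ℕ) (v : Fin n) : ℕ :=
  if v ∈ G.eve then ((G.succs v).map fun w => threshold T (G.prio v) (a w)).foldl min T.size
  else ((G.succs v).map fun w => threshold T (G.prio v) (a w)).foldl max 0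

variable {G T}

theorem Represents.localCond_iff {a : ℕ → ℕ} {μ : Fin n → T.Value} (h : Represents T a μ)
    (v : Fin n) (x : T.Value) : LocalCond G T μ v x ↔ liftCode G T a v ≤ T.code x := by
  unfold LocalCond liftCode
  split_ifs with hv
  · rw [foldl_min_le_iff]
    simp only [List.mem_map, G.mem_succs]
    constructor
    · rintro ⟨w, hw, hp⟩
      exact Or.inr ⟨_, ⟨w, ⟨w, hw, rfl⟩, rfl⟩, by rwa [h w, ← progress_iff_threshold_le]⟩
    · rintro (hx | ⟨_, ⟨_, ⟨w, hw, rfl⟩, rfl⟩, hp⟩)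
      · obtain ⟨w, hw⟩ := G.total v
        exact ⟨w, hw, (progress_iff_threshold_le T _ _ _).2 ((threshold_le_size T _ _).trans hx)⟩
      · exact ⟨w, hw, by rwa [h w, ← progress_iff_threshold_le] at hp⟩
  · rw [foldl_max_le_iff]
    simp only [List.mem_map, G.mem_succs]
    constructor
    · rintro hx
      refine ⟨Nat.zero_le _, ?_⟩
      rintro _ ⟨_, ⟨w, hw, rfl⟩, rfl⟩
      rw [h w, ← progress_iff_threshold_le]
      exact hx w hw
    · rintro ⟨-, hx⟩ w hw
      rw [progress_iff_threshold_le, ← h w]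
      exact hx _ ⟨_, ⟨w, hw, rfl⟩, rfl⟩

theorem liftCode_le_size (a : ℕ → ℕ) (v : Fin n) : liftCode G T a v ≤ T.size := by
  unfold liftCode
  split_ifs
  · exact (foldl_min_le_iff _ _ _).2 (Or.inl le_rfl)
  · rw [foldl_max_le_iff]
    refine ⟨Nat.zero_le _, fun y hy => ?_⟩
    obtain ⟨w, -, rfl⟩ := List.mem_map.1 hy
    exact threshold_le_size _ _ _

theorem Represents.code_lift {a : ℕ → ℕ} {μ : Fin n → T.Value} (h : Represents T a μ)
    (v : Fin n) : T.code (lift G T μ v) = liftCode G T a v := by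
  obtain ⟨y, hy⟩ := T.exists_code_eq (liftCode_le_size (G := G) (T := T) a v)
  rw [← hy]
  congr 1
  have hloc : ∀ x, LocalCond G T μ v x ↔ y ≤ x := fun x => by
    rw [h.localCond_iff, ← hy, T.code_le_code]
  apply le_antisymm
  · cases y using WithTop.recTopCoe with
    | top => exact le_top
    | coe b => exact Finset.inf_le (by simp [hloc])
  · refine Finset.le_inf fun b hb => ?_
    simpa [hloc] using hb

variable (T) in
theorem exists_represents (μ : Fin n → T.Value) : ∃ a, Represents T a μ :=
  ⟨fun i => if h : i < n then T.code (μ ⟨i, h⟩) else 0, fun v => by simp⟩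

/-- `Lift_v(μ)` is the least value satisfying the signature condition at `v`. -/
theorem lift_le_iff {μ : Fin n → T.Value} {v : Fin n} {x : T.Value} :
    lift G T μ v ≤ x ↔ LocalCond G T μ v x := by
  obtain ⟨a, ha⟩ := exists_represents T μ
  rw [ha.localCond_iff, ← ha.code_lift, T.code_le_code]

theorem ancestor_mono (k : ℕ) : Monotone (T.ancestor k) := by
  refine WithTop.monotone_map_iff.2 fun a b hab => ?_
  exact OrderDual.toDual_le_toDual.2 (take_le_take hab k)

theorem Progress.mono {p : ℕ} {x y y' : T.Value} (h : Progress T p x y') (hy : y ≤ y') :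
    Progress T p x y := by
  unfold Progress at *
  split_ifs at * with hp
  · exact h.imp_left fun h => (ancestor_mono _ hy).trans_lt h
  · exact (ancestor_mono _ hy).trans h

theorem lift_mono {μ ν : Fin n → T.Value} (h : μ ≤ ν) (v : Fin n) :
    lift G T μ v ≤ lift G T ν v := by
  have hν : LocalCond G T ν v (lift G T ν v) := lift_le_iff.1 le_rfl
  rw [lift_le_iff]
  unfold LocalCond at *
  split_ifs at * with hv
  · obtain ⟨w, hw, hp⟩ := hν
    exact ⟨w, hw, hp.mono (h w)⟩
  · exact fun w hw => (hν w hw).mono (h w)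

theorem isSignature_iff {μ : Fin n → T.Value} : IsSignature G T μ ↔ ∀ v, lift G T μ v ≤ μ v :=
  forall_congr' fun _ => lift_le_iff.symm

theorem leafMin_le (x : T.Value) : leafMin T ≤ x := by
  cases x using WithTop.recTopCoe with
  | top => exact le_top
  | coe b => exact Finset.inf_le (Finset.mem_univ _)

theorem code_leafMin : T.code (leafMin T) = 0 := by
  obtain ⟨x, hx⟩ := T.exists_code_eq (Nat.zero_le _)
  have := T.code_strictMono.monotone (leafMin_le x)
  omega

theorem LoopStep.le_lift {μ μ' : Fin n → T.Value} (h : LoopStep G T μ μ')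
    (hμ : ∀ v, μ v ≤ lift G T μ v) : μ < μ' ∧ ∀ v, μ' v ≤ lift G T μ' v := by
  obtain ⟨v, hv, rfl⟩ := h
  have hlt : μ < Function.update μ v (lift G T μ v) := by
    rw [lt_update_self_iff]
    exact lt_of_le_of_ne (hμ v) hv
  refine ⟨hlt, fun u => ?_⟩
  rcases eq_or_ne u v with rfl | hu
  · rw [Function.update_self]
    exact lift_mono hlt.le u
  · rw [Function.update_of_ne hu]
    exact (hμ u).trans (lift_mono hlt.le u)

theorem LoopStep.le_of_isSignature {μ μ' ν : Fin n → T.Value} (h : LoopStep G T μ μ')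
    (hν : IsSignature G T ν) (hμ : μ ≤ ν) : μ' ≤ ν := by
  obtain ⟨v, hv, rfl⟩ := h
  rw [update_le_iff]
  exact ⟨(lift_mono hμ v).trans (isSignature_iff.1 hν v), fun u _ => hμ u⟩

theorem sum_code_lt {μ μ' : Fin n → T.Value} (h : μ < μ') :
    ∑ v, T.code (μ v) < ∑ v, T.code (μ' v) := by
  rw [Pi.lt_def] at h
  obtain ⟨h, v, hv⟩ := h
  exact Finset.sum_lt_sum (fun u _ => T.code_strictMono.monotone (h u))
    ⟨v, Finset.mem_univ _, T.code_strictMono hv⟩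

theorem sum_code_le (μ : Fin n → T.Value) : ∑ v, T.code (μ v) ≤ n * T.size := by
  simpa using Finset.sum_le_card_nsmul Finset.univ (fun v => T.code (μ v)) T.size
    fun v _ => T.code_le_size _

theorem loop_run_le {k : ℕ} {r : ℕ → Fin n → T.Value} (h0 : r 0 = fun _ => leafMin T)
    (h : ∀ i < k, LoopStep G T (r i) (r (i + 1))) : k ≤ n * T.size := by
  have key : ∀ i ≤ k, (∀ v, r i v ≤ lift G T (r i) v) ∧ i ≤ ∑ v, T.code (r i v) := by
    intro i
    induction i with
    | zero => exact fun _ => ⟨fun v => by rw [h0]; exact leafMin_le _, Nat.zero_le _⟩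
    | succ i ih =>
      intro hi
      obtain ⟨h1, h2⟩ := ih (by omega)
      obtain ⟨h3, h4⟩ := (h i hi).le_lift h1
      exact ⟨h4, h2.trans_lt (sum_code_lt h3)⟩
  exact (key k le_rfl).2.trans (sum_code_le _)

theorem IsOutput.isSignature {μ : Fin n → T.Value} (h : IsOutput G T μ) : IsSignature G T μ :=
  isSignature_iff.2 fun v => (h.2 v).ge

/-- The output of the algorithm is the least signature. -/
theorem IsOutput.le {μ ν : Fin n → T.Value} (h : IsOutput G T μ) (hν : IsSignature G T ν) :
    μ ≤ ν := by
  obtain ⟨hrun, -⟩ := h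
  induction hrun with
  | refl => exact fun v => leafMin_le _
  | tail _ hstep ih => exact hstep.le_of_isSignature hν ih

theorem IsOutput.eq {μ ν : Fin n → T.Value} (h : IsOutput G T μ) (hν : IsOutput G T ν) : μ = ν :=
  le_antisymm (h.le hν.isSignature) (hν.le h.isSignature)

end Lifting

/-! ### Plays along which ranks decrease -/

open Filter

section Plays

variable {V : Type*} [Finite V] (prio : V → ℕ) (π : ℕ → V)

theorem exists_max_frequent_prio :
    ∃ p, (∃ᶠ i in atTop, prio (π i) = p) ∧ ∀ q, (∃ᶠ i in atTop, prio (π i) = q) → q ≤ p := by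
  have hfin : {q | ∃ᶠ i in atTop, prio (π i) = q}.Finite := by
    refine (Set.finite_range prio).subset fun q hq => ?_
    obtain ⟨i, hi⟩ := hq.exists
    exact ⟨π i, hi⟩
  have hne : {q | ∃ᶠ i in atTop, prio (π i) = q}.Nonempty := by
    by_contra h
    rw [Set.not_nonempty_iff_eq_empty, Set.eq_empty_iff_forall_notMem] at h
    have h' : ∀ v : V, ∀ᶠ i in atTop, prio (π i) ≠ prio v := fun v => not_frequently.1 (h (prio v))
    obtain ⟨i, hi⟩ := (eventually_all.2 h').exists
    exact hi (π i) rfl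
  obtain ⟨p, hp, hmax⟩ := Set.exists_max_image _ id hfin hne
  exact ⟨p, hp, hmax⟩

/-- If along a play the rank at level `q` never increases at a vertex of priority at most `q`, and
strictly decreases at every vertex of priority `q` with `q` bad, then the largest priority
appearing infinitely often is not bad: otherwise the finitely many ranks at its level would
eventually decrease forever. -/
theorem not_bad_of_rank_decreasing {prio : V → ℕ} {π : ℕ → V} {α : Type*} [LinearOrder α]
    (R : ℕ → V → α) (bad : ℕ → Prop)
    (hle : ∀ i, ∀ q, prio (π i) ≤ q → R q (π (i + 1)) ≤ R q (π i))
    (hlt : ∀ i, bad (prio (π i)) → R (prio (π i)) (π (i + 1)) < R (prio (π i)) (π i))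
    {p : ℕ} (hp : ∃ᶠ i in atTop, prio (π i) = p)
    (hmax : ∀ q, (∃ᶠ i in atTop, prio (π i) = q) → q ≤ p) : ¬ bad p := by
  intro hbad
  have hev : ∀ᶠ i in atTop, ∀ v, p < prio v → π i ≠ v := by
    refine eventually_all.2 fun v => ?_
    by_contra h
    simp only [not_eventually, Classical.not_imp, not_not, ne_eq] at h
    obtain ⟨i, hi, -⟩ := h.exists
    exact absurd (hmax (prio v) (h.mono fun i hi => by rw [hi.2])) (not_le.2 hi)
  obtain ⟨N, hN⟩ := eventually_atTop.1 hev
  have hanti : ∀ i ≥ N, ∀ j ≥ i, R p (π j) ≤ R p (π i) := by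
    intro i hi j hj
    induction j, hj using Nat.le_induction with
    | base => exact le_rfl
    | succ j hj ih =>
      refine (hle j p ?_).trans ih
      by_contra h
      exact hN j (hi.trans hj) (π j) (not_le.1 h) rfl
  obtain ⟨-, ⟨i₀, hi₀, rfl⟩, hmin⟩ := Set.exists_min_image ((fun i => R p (π i)) '' Set.Ici N) id
    ((Set.finite_range (R p)).subset (by rintro _ ⟨i, -, rfl⟩; exact ⟨π i, rfl⟩))
    ⟨_, N, Set.self_mem_Ici, rfl⟩
  obtain ⟨j, hj, hjp⟩ := frequently_atTop.1 hp i₀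
  have h1 := hlt j (hjp ▸ hbad)
  rw [hjp] at h1
  have h2 := hmin _ ⟨j + 1, by simp only [Set.mem_Ici] at *; omega, rfl⟩
  exact absurd (h1.trans_le (hanti i₀ hi₀ j hj)) (not_lt.2 h2)

end Plays

/-! ### Signatures give winning strategies -/

section SignatureStrategy

variable {n d : ℕ} {G : ParityGame n d} {T : OrdTree (d / 2)}

theorem Progress.ne_top {p : ℕ} {x y : T.Value} (h : Progress T p x y) (hx : x ≠ ⊤) : y ≠ ⊤ := by
  rintro rfl
  unfold Progress OrdTree.ancestor at h
  split_ifs at h <;> simp_all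

theorem Progress.ancestor_le {p q : ℕ} {x y : T.Value} (h : Progress T p x y) (hx : x ≠ ⊤)
    (hq : p ≤ q) : T.ancestor (levelDepth d q) y ≤ T.ancestor (levelDepth d q) x := by
  have hy := h.ne_top hx
  lift x to (T.Leaf)ᵒᵈ using hx
  lift y to (T.Leaf)ᵒᵈ using hy
  have hle : (OrderDual.ofDual x).1.take (levelDepth d p) ≤
      (OrderDual.ofDual y).1.take (levelDepth d p) := by
    unfold Progress OrdTree.ancestor at h
    split_ifs at h
    · simp only [WithTop.map_coe, WithTop.coe_lt_coe, WithTop.coe_ne_top, or_false] at h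
      exact le_of_lt (OrderDual.toDual_lt_toDual.1 h)
    · simp only [WithTop.map_coe, WithTop.coe_le_coe] at h
      exact OrderDual.toDual_le_toDual.1 h
  have hk : levelDepth d q ≤ levelDepth d p := by unfold levelDepth; omega
  have := take_le_take hle (levelDepth d q)
  rw [List.take_take, List.take_take, min_eq_left hk] at this
  simp only [OrdTree.ancestor, WithTop.map_coe, WithTop.coe_le_coe]
  exact OrderDual.toDual_le_toDual.2 this

theorem ParityGame.play_succ (σ τ : G.Strategy) (v : Fin n) (i : ℕ) :
    ∃ hist, G.play σ τ v (i + 1) =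
      if G.play σ τ v i ∈ G.eve then σ.1 hist (G.play σ τ v i) else τ.1 hist (G.play σ τ v i) :=
  ⟨_, rfl⟩

theorem IsSignature.eveWins {μ : Fin n → T.Value} (hμ : IsSignature G T μ) {v : Fin n}
    (hv : μ v ≠ ⊤) : G.EveWins v := by
  have hchoice : ∀ u, ∃ w, (u, w) ∈ G.edges ∧
      (u ∈ G.eve → Progress T (G.prio u) (μ u) (μ w)) := by
    intro u
    by_cases hu : u ∈ G.eve
    · have := hμ u
      rw [LocalCond, if_pos hu] at this
      obtain ⟨w, hw, hp⟩ := this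
      exact ⟨w, hw, fun _ => hp⟩
    · obtain ⟨w, hw⟩ := G.total u
      exact ⟨w, hw, fun h => absurd h hu⟩
  choose f hf hfp using hchoice
  refine ⟨⟨fun _ u => f u, fun _ u => hf u⟩, fun τ => ?_⟩
  set π := G.play ⟨fun _ u => f u, fun _ u => hf u⟩ τ v with hπ
  have hstep : ∀ i, Progress T (G.prio (π i)) (μ (π i)) (μ (π (i + 1))) := by
    intro i
    obtain ⟨hist, hi⟩ := ParityGame.play_succ ⟨fun _ u => f u, fun _ u => hf u⟩ τ v i
    rw [← hπ] at hi
    rw [hi]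
    split_ifs with hu
    · exact hfp _ hu
    · have := hμ (π i)
      rw [LocalCond, if_neg hu] at this
      exact this _ (τ.2 _ _)
  have htop : ∀ i, μ (π i) ≠ ⊤ := by
    intro i
    induction i with
    | zero => exact hv
    | succ i ih => exact (hstep i).ne_top ih
  obtain ⟨p, hp, hmax⟩ := exists_max_frequent_prio G.prio π
  refine ⟨p, ?_, hp, hmax⟩
  rw [← Nat.not_odd_iff_even]
  refine not_bad_of_rank_decreasing (fun q u => T.ancestor (levelDepth d q) (μ u)) Odd
    (fun i q hq => (hstep i).ancestor_le (htop i) hq) (fun i hi => ?_) hp hmax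
  have := hstep i
  rw [Progress, if_pos hi] at this
  exact this.resolve_right (htop i)

end SignatureStrategy

/-! ### Positional determinacy with ranks -/

section Determinacy

variable {V : Type*} (E : V → V → Prop) (prio : V → ℕ)

/-- The rank at the level of the priority of `v` does not increase along the edge from `v` to `w`,
and it decreases if that priority is bad. -/
def RankProgress (bad : ℕ → Prop) (R : ℕ → V → ℕ) (v w : V) : Prop :=
  R (prio v) w ≤ R (prio v) v ∧ (bad (prio v) → R (prio v) w < R (prio v) v)

/-- In the subgame on the vertex set `S`, the player who owns the vertices in `ctl`, and for whom
the priorities in `bad` are the losing ones, has a progress measure on `W ⊆ S`: a family of ranks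
`R q`, one for each level `q`, where `R q` refines `R (q + 1)`, such that this player can make
progress within `W` and the opponent cannot avoid it. -/
def HasRanking (ctl : V → Prop) (bad : ℕ → Prop) (S W : Set V) : Prop :=
  W ⊆ S ∧ ∃ R : ℕ → V → ℕ,
    (∀ q, ∀ v ∈ W, ∀ w ∈ W, R q v ≤ R q w → R (q + 1) v ≤ R (q + 1) w) ∧
    (∀ v ∈ W, ctl v → ∃ w ∈ W, E v w ∧ RankProgress prio bad R v w) ∧
    ∀ v ∈ W, ¬ ctl v → ∀ w ∈ S, E v w → w ∈ W ∧ RankProgress prio bad R v w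

variable {E prio} {ctl : V → Prop} {bad : ℕ → Prop} {S S' W X A U : Set V}

theorem HasRanking.mono_of_trap (h : HasRanking E prio ctl bad S' W) (hS : S' ⊆ S)
    (htrap : ∀ v ∈ S', ¬ ctl v → ∀ w ∈ S, E v w → w ∈ S') : HasRanking E prio ctl bad S W := by
  obtain ⟨hW, R, h1, h2, h3⟩ := h
  exact ⟨hW.trans hS, R, h1, h2,
    fun v hv hc w hw he => h3 v hv hc w (htrap v (hW hv) hc w hw he) he⟩

variable (E ctl S X A) in
/-- `A` is the attractor to `X` of the owner of `ctl` in the subgame on `S`; the function `r`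
decreases on the way to `X`. -/
structure IsAttractor (r : V → ℕ) : Prop where
  base_subset : X ⊆ A
  subset : A ⊆ S
  exists_edge : ∀ v ∈ A, v ∉ X → ctl v → ∃ w ∈ A, E v w ∧ r w < r v
  forall_edge : ∀ v ∈ A, v ∉ X → ¬ ctl v → ∀ w ∈ S, E v w → w ∈ A ∧ r w < r v
  not_edge : ∀ v ∈ S, v ∉ A → ctl v → ∀ w ∈ A, ¬ E v w
  exists_escape : ∀ v ∈ S, v ∉ A → ¬ ctl v → ∃ w ∈ S, E v w ∧ w ∉ A

theorem exists_isAttractor [Fintype V] (E : V → V → Prop) (ctl : V → Prop) (hX : X ⊆ S) :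
    ∃ A r, IsAttractor E ctl S X A r := by
  classical
  -- `stage k` is the set from which `X` can be forced within `k` moves
  let stage : ℕ → Set V := fun k => Nat.rec (motive := fun _ => Set V) X
    (fun _ B => B ∪ {v | v ∈ S ∧
      (ctl v → ∃ w ∈ B, E v w) ∧ (¬ ctl v → ∀ w ∈ S, E v w → w ∈ B)}) k
  have hsucc : ∀ k, stage (k + 1) = stage k ∪ {v | v ∈ S ∧
    (ctl v → ∃ w ∈ stage k, E v w) ∧ (¬ ctl v → ∀ w ∈ S, E v w → w ∈ stage k)} := fun _ => rfl
  have hmono : Monotone stage := monotone_nat_of_le_succ fun k => by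
    rw [hsucc]; exact Set.subset_union_left
  have hsub : ∀ k, stage k ⊆ S := by
    intro k
    induction k with
    | zero => exact hX
    | succ k ih => rw [hsucc]; exact Set.union_subset ih fun v hv => hv.1
  let r : V → ℕ := fun v => sInf {k | v ∈ stage k}
  have hr : ∀ {v k}, v ∈ stage k → v ∈ stage (r v) ∧ r v ≤ k := by
    intro v k hk
    exact ⟨Nat.sInf_mem (s := {k | v ∈ stage k}) ⟨k, hk⟩, Nat.sInf_le hk⟩
  have hpos : ∀ {v k}, v ∈ stage k → v ∉ X → ∃ j, r v = j + 1 ∧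
      (ctl v → ∃ w ∈ stage j, E v w) ∧ (¬ ctl v → ∀ w ∈ S, E v w → w ∈ stage j) := by
    intro v k hk hv
    obtain ⟨h1, -⟩ := hr hk
    rcases hj : r v with _ | j
    · rw [hj] at h1; exact absurd h1 hv
    · rw [hj, hsucc] at h1
      rcases h1 with h1 | h1
      · have := (hr h1).2; omega
      · exact ⟨j, rfl, h1.2⟩
  refine ⟨⋃ k, stage k, r, Set.subset_iUnion stage 0, Set.iUnion_subset hsub, ?_, ?_, ?_, ?_⟩
  · intro v hv hvX hc
    obtain ⟨k, hk⟩ := Set.mem_iUnion.1 hv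
    obtain ⟨j, hj, h1, -⟩ := hpos hk hvX
    obtain ⟨w, hw, he⟩ := h1 hc
    exact ⟨w, Set.mem_iUnion.2 ⟨j, hw⟩, he, by have := (hr hw).2; omega⟩
  · intro v hv hvX hc w hw he
    obtain ⟨k, hk⟩ := Set.mem_iUnion.1 hv
    obtain ⟨j, hj, -, h1⟩ := hpos hk hvX
    have := h1 hc w hw he
    exact ⟨Set.mem_iUnion.2 ⟨j, this⟩, by have := (hr this).2; omega⟩
  · intro v hv hvA hc w hw he
    obtain ⟨k, hk⟩ := Set.mem_iUnion.1 hw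
    refine hvA (Set.mem_iUnion.2 ⟨k + 1, ?_⟩)
    rw [hsucc]
    exact Or.inr ⟨hv, fun _ => ⟨w, hk, he⟩, fun h => absurd hc h⟩
  · intro v hv hvA hc
    by_contra! hcon
    -- finitely many successors enter the attractor at a common stage
    refine hvA (Set.mem_iUnion.2 ⟨Finset.univ.sup r + 1, ?_⟩)
    rw [hsucc]
    refine Or.inr ⟨hv, fun h => absurd h hc, fun _ w hw he => ?_⟩
    obtain ⟨k, hk⟩ := Set.mem_iUnion.1 (hcon w hw he)
    exact hmono (Finset.le_sup (Finset.mem_univ w)) (hr hk).1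

theorem exists_rank_bound [Fintype V] (R : ℕ → V → ℕ) (t : ℕ) : ∃ K, ∀ q < t, ∀ v, R q v < K := by
  refine ⟨(Finset.range t).sup (fun q => Finset.univ.sup (R q)) + 1, fun q hq v => ?_⟩
  have h1 : R q v ≤ Finset.univ.sup (R q) := Finset.le_sup (Finset.mem_univ v)
  have h2 : Finset.univ.sup (R q) ≤ (Finset.range t).sup (fun q => Finset.univ.sup (R q)) :=
    Finset.le_sup (f := fun q => Finset.univ.sup (R q)) (Finset.mem_range.2 hq)
  omega

/-- Ranks on `X`, on the attractor `A` to `X`, and on a part `U` of the rest are put one on top of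
the other at all levels below `t`; at the levels from `t` on, the new ranks are constant. Hence
vertices of `X` whose priority is good and at least `t` may move anywhere. -/
theorem HasRanking.glue [Fintype V] {r : V → ℕ} {R : ℕ → V → ℕ} {t : ℕ}
    (hA : IsAttractor E ctl S X A r) (hU : HasRanking E prio ctl bad (S \ A) U)
    (ht : ∀ v ∈ S, v ∉ X → prio v < t)
    (hR : ∀ q, ∀ v ∈ X, ∀ w ∈ X, R q v ≤ R q w → R (q + 1) v ≤ R (q + 1) w)
    (hctl : ∀ v ∈ X, ctl v → ∃ w ∈ A ∪ U, E v w ∧ (t ≤ prio v ∧ ¬ bad (prio v) ∨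
      prio v < t ∧ w ∈ X ∧ RankProgress prio bad R v w))
    (hopp : ∀ v ∈ X, ¬ ctl v → ∀ w ∈ S, E v w → w ∈ A ∪ U ∧ (t ≤ prio v ∧ ¬ bad (prio v) ∨
      prio v < t ∧ w ∈ X ∧ RankProgress prio bad R v w)) :
    HasRanking E prio ctl bad S (A ∪ U) := by
  classical
  obtain ⟨hUS, R', hR', hctl', hopp'⟩ := hU
  obtain ⟨K₁, hK₁⟩ := exists_rank_bound R t
  obtain ⟨K₂, hK₂⟩ := exists_rank_bound (fun _ v => K₁ + r v) 1
  replace hK₂ : ∀ v, K₁ + r v < K₂ := hK₂ 0 one_pos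
  have hUA : ∀ v ∈ U, v ∉ A := fun v hv => (hUS hv).2
  have hAX : ∀ v, v ∉ A → v ∉ X := fun v hv h => hv (hA.base_subset h)
  set Q : ℕ → V → ℕ := fun q v => if q < t then
    (if v ∈ X then R q v else if v ∈ A then K₁ + r v else K₂ + R' q v) else 0 with hQ
  have hfree : ∀ v w, t ≤ prio v → ¬ bad (prio v) → RankProgress prio bad Q v w := by
    intro v w h1 h2
    simp [RankProgress, hQ, not_lt.2 h1, h2]
  have hdrop : ∀ v w, Q (prio v) w < Q (prio v) v → RankProgress prio bad Q v w :=
    fun v w h => ⟨h.le, fun _ => h⟩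
  have hbase : ∀ v ∈ X, ∀ w ∈ X, prio v < t → RankProgress prio bad R v w →
      RankProgress prio bad Q v w := by
    intro v hv w hw h1 h2
    simpa [RankProgress, hQ, h1, hv, hw] using h2
  have hattr : ∀ v ∈ A, v ∉ X → ∀ w ∈ A, r w < r v → RankProgress prio bad Q v w := by
    intro v hv hvX w hw h
    have h1 := ht v (hA.subset hv) hvX
    refine hdrop v w ?_
    have := hK₁ _ h1 w
    simp only [hQ, if_pos h1, if_neg hvX, if_pos hv, if_pos hw]
    split_ifs <;> omega
  have hrest : ∀ v ∈ U, ∀ w ∈ U, RankProgress prio bad R' v w → RankProgress prio bad Q v w := by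
    intro v hv w hw h
    have h1 := ht v (hUS hv).1 (hAX v (hUA v hv))
    simpa [RankProgress, hQ, h1, hUA v hv, hUA w hw, hAX v (hUA v hv), hAX w (hUA w hw)] using h
  have hrestA : ∀ v ∈ U, ∀ w ∈ A, RankProgress prio bad Q v w := by
    intro v hv w hw
    have h1 := ht v (hUS hv).1 (hAX v (hUA v hv))
    refine hdrop v w ?_
    have h2 := hK₁ _ h1 w
    have h3 := hK₂ w
    simp only [hQ, if_pos h1, if_neg (hAX v (hUA v hv)), if_neg (hUA v hv), if_pos hw]
    split_ifs <;> omega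
  refine ⟨Set.union_subset hA.subset fun v hv => (hUS hv).1, Q, ?_, ?_, ?_⟩
  · intro q v hv w hw hle
    by_cases hq : q + 1 < t
    swap
    · simp [hQ, hq]
    have hq' : q < t := by omega
    have h1 := hK₁ _ hq v
    have h2 := hK₁ _ hq w
    have h3 := hK₂ v
    have h4 := hK₂ w
    have h5 := hK₁ _ hq' v
    have h6 := hK₁ _ hq' w
    simp only [hQ, if_pos hq, if_pos hq'] at hle ⊢
    have hUv : v ∉ A → v ∈ U := fun h => hv.resolve_left h
    have hUw : w ∉ A → w ∈ U := fun h => hw.resolve_left h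
    split_ifs at hle ⊢ with hvX hwX hwA hvA hwX hwA hwX hwA
    · exact hR q v hvX w hwX hle
    all_goals try omega
    have := hR' q v (hUv hvA) w (hUw hwA) (by omega)
    omega
  · rintro v (hv | hv) hc
    · by_cases hvX : v ∈ X
      · obtain ⟨w, hw, he, h | h⟩ := hctl v hvX hc
        · exact ⟨w, hw, he, hfree v w h.1 h.2⟩
        · exact ⟨w, hw, he, hbase v hvX w h.2.1 h.1 h.2.2⟩
      · obtain ⟨w, hw, he, h⟩ := hA.exists_edge v hv hvX hc
        exact ⟨w, Or.inl hw, he, hattr v hv hvX w hw h⟩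
    · obtain ⟨w, hw, he, h⟩ := hctl' v hv hc
      exact ⟨w, Or.inr hw, he, hrest v hv w hw h⟩
  · rintro v (hv | hv) hc w hw he
    · by_cases hvX : v ∈ X
      · obtain ⟨h1, h | h⟩ := hopp v hvX hc w hw he
        · exact ⟨h1, hfree v w h.1 h.2⟩
        · exact ⟨h1, hbase v hvX w h.2.1 h.1 h.2.2⟩
      · obtain ⟨h1, h⟩ := hA.forall_edge v hv hvX hc w hw he
        exact ⟨Or.inl h1, hattr v hv hvX w h1 h⟩
    · by_cases hwA : w ∈ A
      · exact ⟨Or.inl hwA, hrestA v hv w hwA⟩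
      · obtain ⟨h1, h⟩ := hopp' v hv hc w ⟨hw, hwA⟩ he
        exact ⟨Or.inr h1, hrest v hv w h1 h⟩

theorem IsAttractor.exists_edge_diff {r : V → ℕ} (hA : IsAttractor E ctl S X A r)
    (htotal : ∀ v ∈ S, ∃ w ∈ S, E v w) : ∀ v ∈ S \ A, ∃ w ∈ S \ A, E v w := by
  rintro v ⟨hv, hvA⟩
  by_cases hc : ctl v
  · obtain ⟨w, hw, he⟩ := htotal v hv
    exact ⟨w, ⟨hw, fun h => hA.not_edge v hv hvA hc w h he⟩, he⟩
  · obtain ⟨w, hw, he, h⟩ := hA.exists_escape v hv hvA hc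
    exact ⟨w, ⟨hw, h⟩, he⟩

/-- One step of Zielonka's recursion, for a player for whom the largest priority is good. -/
theorem exists_rankings_step [Fintype V] {p : ℕ}
    (hp : ∃ v ∈ S, prio v = p) (hmax : ∀ v ∈ S, prio v ≤ p) (hgood : ¬ bad p)
    (htotal : ∀ v ∈ S, ∃ w ∈ S, E v w)
    (ih : ∀ S' ⊂ S, (∀ v ∈ S', ∃ w ∈ S', E v w) → ∃ W₀ W₁, S' ⊆ W₀ ∪ W₁ ∧
      HasRanking E prio ctl bad S' W₀ ∧
      HasRanking E prio (fun v => ¬ ctl v) (fun q => ¬ bad q) S' W₁) :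
    ∃ W₀ W₁, S ⊆ W₀ ∪ W₁ ∧ HasRanking E prio ctl bad S W₀ ∧
      HasRanking E prio (fun v => ¬ ctl v) (fun q => ¬ bad q) S W₁ := by
  obtain ⟨A, r, hA⟩ := exists_isAttractor E ctl (X := {v | v ∈ S ∧ prio v = p}) (S := S)
    fun v hv => hv.1
  obtain ⟨v₀, hv₀, hpv₀⟩ := hp
  have hssub : S \ A ⊂ S := ⟨Set.sdiff_subset, fun h => (h hv₀).2 (hA.base_subset ⟨hv₀, hpv₀⟩)⟩
  obtain ⟨W₀, W₁, hW, h₀, h₁⟩ := ih (S \ A) hssub (hA.exists_edge_diff htotal)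
  rcases W₁.eq_empty_or_nonempty with rfl | ⟨v₁, hv₁⟩
  · -- the player wins the rest of the subgame, and hence all of it
    have hS : S = A ∪ W₀ := by
      refine Set.Subset.antisymm (fun v hv => ?_)
        (Set.union_subset hA.subset (h₀.1.trans Set.sdiff_subset))
      by_cases hvA : v ∈ A
      · exact Or.inl hvA
      · exact Or.inr ((hW ⟨hv, hvA⟩).resolve_right (Set.notMem_empty v))
    refine ⟨A ∪ W₀, ∅, by rw [Set.union_empty, ← hS], ?_, Set.empty_subset _, fun _ _ => 0, by simp⟩
    refine h₀.glue (R := fun _ _ => 0) (t := p) hA ?_ (fun _ _ _ _ _ _ => le_rfl) ?_ ?_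
    · exact fun v hv hvX => lt_of_le_of_ne (hmax v hv) fun h => hvX ⟨hv, h⟩
    · rintro v ⟨hv, rfl⟩ hc
      obtain ⟨w, hw, he⟩ := htotal v hv
      exact ⟨w, hS ▸ hw, he, Or.inl ⟨le_rfl, hgood⟩⟩
    · rintro v ⟨hv, rfl⟩ hc w hw he
      exact ⟨hS ▸ hw, Or.inl ⟨le_rfl, hgood⟩⟩
  · -- the opponent wins some vertices, and hence their attractor
    have h₁' : HasRanking E prio (fun v => ¬ ctl v) (fun q => ¬ bad q) S W₁ := by
      refine h₁.mono_of_trap Set.sdiff_subset fun v hv hc w hw he => ⟨hw, fun hwA => ?_⟩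
      exact hA.not_edge v hv.1 hv.2 (not_not.1 hc) w hwA he
    obtain ⟨B, s, hB⟩ := exists_isAttractor E (fun v => ¬ ctl v) h₁'.1
    have hssub' : S \ B ⊂ S :=
      ⟨Set.sdiff_subset, fun h => (h (h₁'.1 hv₁)).2 (hB.base_subset hv₁)⟩
    obtain ⟨U₀, U₁, hU, k₀, k₁⟩ := ih (S \ B) hssub' (hB.exists_edge_diff htotal)
    refine ⟨U₀, B ∪ U₁, ?_, ?_, ?_⟩
    · intro v hv
      by_cases hvB : v ∈ B
      · exact Or.inr (Or.inl hvB)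
      · exact (hU ⟨hv, hvB⟩).imp_right Or.inr
    · refine k₀.mono_of_trap Set.sdiff_subset fun v hv hc w hw he => ⟨hw, fun hwB => ?_⟩
      exact hB.not_edge v hv.1 hv.2 hc w hwB he
    · obtain ⟨hsub, R, hR, hctl, hopp⟩ := h₁'
      have hlt : ∀ v ∈ S, prio v < p + 1 := fun v hv => Nat.lt_succ_of_le (hmax v hv)
      refine k₁.glue (R := R) (t := p + 1) hB (fun v hv _ => hlt v hv) hR ?_ ?_
      · intro v hv hc
        obtain ⟨w, hw, he, h⟩ := hctl v hv hc
        exact ⟨w, Or.inl (hB.base_subset hw), he, Or.inr ⟨hlt v (hsub hv), hw, h⟩⟩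
      · intro v hv hc w hw he
        obtain ⟨h1, h⟩ := hopp v hv hc w hw he
        exact ⟨Or.inl (hB.base_subset h1), Or.inr ⟨hlt v (hsub hv), h1, h⟩⟩

/-- Every vertex belongs to a progress measure of one of the two players. -/
theorem exists_rankings [Fintype V] (E : V → V → Prop) (prio : V → ℕ) (S : Set V)
    (htotal : ∀ v ∈ S, ∃ w ∈ S, E v w) (ctl : V → Prop) (bad : ℕ → Prop) :
    ∃ W₀ W₁, S ⊆ W₀ ∪ W₁ ∧ HasRanking E prio ctl bad S W₀ ∧
      HasRanking E prio (fun v => ¬ ctl v) (fun q => ¬ bad q) S W₁ := by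
  induction S using WellFoundedLT.induction generalizing ctl bad with
  | ind S ih =>
    rcases S.eq_empty_or_nonempty with rfl | hne
    · exact ⟨∅, ∅, by simp, ⟨Set.empty_subset _, fun _ _ => 0, by simp⟩,
        ⟨Set.empty_subset _, fun _ _ => 0, by simp⟩⟩
    obtain ⟨v₀, hv₀, hmax⟩ := Set.exists_max_image S prio S.toFinite hne
    by_cases hbad : bad (prio v₀)
    · obtain ⟨W₀, W₁, hW, h₀, h₁⟩ := exists_rankings_step (ctl := fun v => ¬ ctl v)
        (bad := fun q => ¬ bad q) ⟨v₀, hv₀, rfl⟩ hmax (not_not.2 hbad) htotal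
        fun S' hS' ht => ih S' hS' ht _ _
      simp only [not_not] at h₁
      exact ⟨W₁, W₀, by rwa [Set.union_comm], h₁, h₀⟩
    · exact exists_rankings_step ⟨v₀, hv₀, rfl⟩ hmax hbad htotal fun S' hS' ht => ih S' hS' ht _ _

/-- Finer ranks determine coarser ones. -/
theorem rank_le_of_le {R : ℕ → V → ℕ}
    (hR : ∀ q, ∀ v ∈ W, ∀ w ∈ W, R q v ≤ R q w → R (q + 1) v ≤ R (q + 1) w) {p q : ℕ}
    (hpq : p ≤ q) {v w : V} (hv : v ∈ W) (hw : w ∈ W) (h : R p v ≤ R p w) : R q v ≤ R q w := by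
  induction q, hpq using Nat.le_induction with
  | base => exact h
  | succ q _ ih => exact hR q v hv w hw ih

end Determinacy

/-! ### From ranks to universal trees -/

theorem OrdTree.size_node {h k : ℕ} (c : Fin (k + 1) → OrdTree h) :
    (OrdTree.node k c).size = ∑ i, (c i).size := by
  simp [size, leaves, List.length_flatMap, Fin.sum_univ_def]

/-- Nested ranks on a finite set form a tree: the nodes at depth `k` are the rank classes at level
`k`, larger ranks standing further to the left. An embedding of it into `T` gives a map to the
leaves of `T` along which ranks are compared by ancestors. -/
theorem OrdTree.exists_of_ranks {V : Type*} [DecidableEq V] (h : ℕ) (W : Finset V)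
    (hW : W.Nonempty) (R : ℕ → V → ℕ)
    (hR : ∀ k, 1 ≤ k → k < h → ∀ v ∈ W, ∀ w ∈ W, R (k + 1) v ≤ R (k + 1) w → R k v ≤ R k w) :
    ∃ t : OrdTree h, t.size ≤ W.card ∧ ∀ T : OrdTree h, t.Embeds T →
      ∃ φ : V → List ℕ, (∀ v ∈ W, φ v ∈ T.leaves) ∧
        ∀ k, 1 ≤ k → k ≤ h → ∀ v ∈ W, ∀ w ∈ W,
          (R k v ≤ R k w → (φ w).take k ≤ (φ v).take k) ∧
          (R k v < R k w → (φ w).take k < (φ v).take k) := by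
  induction h generalizing W R with
  | zero =>
    refine ⟨.leaf, by simpa [size, leaves] using hW, fun T _ => ⟨fun _ => [], ?_, ?_⟩⟩
    · cases T; simp [leaves]
    · intro k h1 h2; omega
  | succ h ih =>
    obtain ⟨m, hm⟩ : ∃ m, (W.image (R 1)).card = m + 1 :=
      Nat.exists_eq_succ_of_ne_zero (Finset.card_ne_zero.2 (hW.image _))
    -- the ranks at depth `1`, in decreasing order
    let c : Fin (m + 1) → ℕ := fun i => (W.image (R 1)).orderEmbOfFin hm i.rev
    have hc : StrictAnti c := fun i j hij =>
      ((W.image (R 1)).orderEmbOfFin hm).strictMono (Fin.rev_lt_rev.2 hij)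
    have hcmem : ∀ i, ∃ v ∈ W, R 1 v = c i := fun i =>
      Finset.mem_image.1 (Finset.orderEmbOfFin_mem _ hm _)
    have hcsurj : ∀ v, ∃ i, v ∈ W → c i = R 1 v := by
      intro v
      by_cases hv : v ∈ W
      · have : R 1 v ∈ Set.range ((W.image (R 1)).orderEmbOfFin hm) := by
          rw [Finset.range_orderEmbOfFin]
          exact Finset.mem_coe.2 (Finset.mem_image_of_mem _ hv)
        obtain ⟨i, hi⟩ := this
        exact ⟨i.rev, fun _ => by simp [c, hi]⟩
      · exact ⟨0, fun h => absurd h hv⟩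
    choose idx hidx using hcsurj
    let Wc : Fin (m + 1) → Finset V := fun i => W.filter fun v => R 1 v = c i
    have hWc : ∀ i, ∃ t : OrdTree h, t.size ≤ (Wc i).card ∧ ∀ T : OrdTree h, t.Embeds T →
        ∃ φ : V → List ℕ, (∀ v ∈ Wc i, φ v ∈ T.leaves) ∧
          ∀ k, 1 ≤ k → k ≤ h → ∀ v ∈ Wc i, ∀ w ∈ Wc i,
            (R (k + 1) v ≤ R (k + 1) w → (φ w).take k ≤ (φ v).take k) ∧
            (R (k + 1) v < R (k + 1) w → (φ w).take k < (φ v).take k) := by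
      intro i
      refine ih (Wc i) ?_ (fun k => R (k + 1)) ?_
      · obtain ⟨v, hv, h⟩ := hcmem i
        exact ⟨v, Finset.mem_filter.2 ⟨hv, h⟩⟩
      · intro k h1 h2 v hv w hw hle
        exact hR (k + 1) (by omega) (by omega) v (Finset.mem_filter.1 hv).1 w
          (Finset.mem_filter.1 hw).1 hle
    choose t hsize ht using hWc
    refine ⟨.node m t, ?_, ?_⟩
    · rw [size_node]
      refine (Finset.sum_le_sum fun i _ => hsize i).trans ?_
      rw [← Finset.card_biUnion]
      · refine Finset.card_le_card fun v hv => ?_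
        obtain ⟨i, -, hi⟩ := Finset.mem_biUnion.1 hv
        exact (Finset.mem_filter.1 hi).1
      · intro i _ j _ hij
        refine Finset.disjoint_left.2 fun v hi hj => hij (hc.injective ?_)
        exact (Finset.mem_filter.1 hi).2.symm.trans (Finset.mem_filter.1 hj).2
    · intro T hT
      cases T with
      | node k' child =>
        obtain ⟨f, hf, hemb⟩ := hT
        choose φ hφ hφR using fun i => ht i _ (hemb i)
        have hmem : ∀ v ∈ W, v ∈ Wc (idx v) := fun v hv =>
          Finset.mem_filter.2 ⟨hv, (hidx v hv).symm⟩
        have hcoarse : ∀ k, 1 ≤ k → k ≤ h + 1 → ∀ v ∈ W, ∀ w ∈ W, R k v ≤ R k w →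
            R 1 v ≤ R 1 w := by
          intro k hk
          induction k, hk using Nat.le_induction with
          | base => exact fun _ _ _ _ _ h => h
          | succ k hk ihk =>
            exact fun hkh v hv w hw hle =>
              ihk (by omega) v hv w hw (hR k hk (by omega) v hv w hw hle)
        refine ⟨fun v => (f (idx v) : ℕ) :: φ (idx v) v, ?_, ?_⟩
        · intro v hv
          simp only [leaves, List.mem_flatMap, List.mem_map]
          exact ⟨f (idx v), List.mem_finRange _, _, hφ _ v (hmem v hv), rfl⟩
        · intro k h1 h2 v hv w hw
          obtain ⟨k, rfl⟩ : ∃ j, k = j + 1 := ⟨k - 1, by omega⟩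
          simp only [List.take_succ_cons]
          by_cases heq : idx v = idx w
          · have hw' := hmem w hw
            rw [← heq] at hw' ⊢
            rcases Nat.eq_zero_or_pos k with rfl | hk
            · have h3 : R 1 v = R 1 w := by rw [← hidx v hv, ← hidx w hw, heq]
              simp [h3]
            · obtain ⟨h3, h4⟩ := hφR (idx v) k hk (by omega) v (hmem v hv) w hw'
              exact ⟨fun h => List.cons_le_cons _ (h3 h),
                fun h => List.cons_lt_cons_iff.2 (Or.inr ⟨rfl, h4 h⟩)⟩
          · have hne : R 1 v ≠ R 1 w := by
              rw [← hidx v hv, ← hidx w hw]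
              exact fun h => heq (hc.injective h)
            have key : R (k + 1) v ≤ R (k + 1) w →
                (f (idx w) : ℕ) :: (φ (idx w) w).take k <
                  (f (idx v) : ℕ) :: (φ (idx v) v).take k := by
              intro hle
              have h3 := lt_of_le_of_ne (hcoarse _ h1 h2 v hv w hw hle) hne
              rw [← hidx v hv, ← hidx w hw] at h3
              exact List.cons_lt_cons_iff.2 (Or.inl (hf (hc.lt_iff_gt.1 h3)))
            exact ⟨fun h => (key h).le, fun h => key h.le⟩

/-! ### Winning vertices have a signature -/

section Completeness

variable {n d : ℕ} {G : ParityGame n d}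

/-- Eve does not win from a vertex of a progress measure for Adam, whose bad priorities are the
even ones. -/
theorem not_eveWins_of_hasRanking {W : Set (Fin n)}
    (h : HasRanking (fun v w => (v, w) ∈ G.edges) G.prio (fun v => ¬ v ∈ G.eve)
      (fun q => ¬ Odd q) Set.univ W) {v : Fin n} (hv : v ∈ W) : ¬ G.EveWins v := by
  rintro ⟨σ, hσ⟩
  obtain ⟨-, R, hR, hctl, hopp⟩ := h
  have hchoice : ∀ u, ∃ w, (u, w) ∈ G.edges ∧ (u ∈ W → u ∉ G.eve → w ∈ W ∧
      RankProgress G.prio (fun q => ¬ Odd q) R u w) := by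
    intro u
    by_cases hu : u ∈ W ∧ u ∉ G.eve
    · obtain ⟨w, hw, he, h⟩ := hctl u hu.1 hu.2
      exact ⟨w, he, fun _ _ => ⟨hw, h⟩⟩
    · obtain ⟨w, hw⟩ := G.total u
      exact ⟨w, hw, fun h1 h2 => absurd ⟨h1, h2⟩ hu⟩
  choose f hf hfp using hchoice
  let τ : G.Strategy := ⟨fun _ u => f u, fun _ u => hf u⟩
  obtain ⟨p, hpe, hp, hmax⟩ := hσ τ
  set π := G.play σ τ v with hπ
  have hstep : ∀ i, π i ∈ W → π (i + 1) ∈ W ∧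
      RankProgress G.prio (fun q => ¬ Odd q) R (π i) (π (i + 1)) := by
    intro i hi
    obtain ⟨hist, h⟩ := ParityGame.play_succ σ τ v i
    rw [← hπ] at h
    rw [h]
    split_ifs with hu
    · exact hopp _ hi (not_not.2 hu) _ (Set.mem_univ _) (σ.2 _ _)
    · exact hfp _ hi hu
  have hmem : ∀ i, π i ∈ W := by
    intro i
    induction i with
    | zero => exact hv
    | succ i ih => exact (hstep i ih).1
  refine not_bad_of_rank_decreasing R (fun q => ¬ Odd q) (fun i q hq => ?_)
    (fun i hi => (hstep i (hmem i)).2.2 hi) hp hmax (Nat.not_odd_iff_even.2 hpe)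
  exact rank_le_of_le hR hq (hmem _) (hmem _) (hstep i (hmem i)).2.1

theorem isSignature_of_ranks {T : OrdTree (d / 2)} (hd : Even d) {W : Set (Fin n)}
    {R : ℕ → Fin n → ℕ}
    (hR : ∀ q, ∀ v ∈ W, ∀ w ∈ W, R q v ≤ R q w → R (q + 1) v ≤ R (q + 1) w)
    (hctl : ∀ v ∈ W, v ∈ G.eve → ∃ w ∈ W, (v, w) ∈ G.edges ∧ RankProgress G.prio Odd R v w)
    (hopp : ∀ v ∈ W, v ∉ G.eve → ∀ w, (v, w) ∈ G.edges → w ∈ W ∧ RankProgress G.prio Odd R v w)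
    {φ : Fin n → T.Leaf}
    (hφ : ∀ k, 1 ≤ k → k ≤ d / 2 → ∀ v ∈ W, ∀ w ∈ W,
      (R (d + 1 - 2 * k) v ≤ R (d + 1 - 2 * k) w → (φ w).1.take k ≤ (φ v).1.take k) ∧
      (R (d + 1 - 2 * k) v < R (d + 1 - 2 * k) w → (φ w).1.take k < (φ v).1.take k))
    {ν : Fin n → T.Value} (hν : ∀ v ∈ W, ν v = (OrderDual.toDual (φ v) : (T.Leaf)ᵒᵈ))
    (hν' : ∀ v ∉ W, ν v = ⊤) : IsSignature G T ν := by
  obtain ⟨e, rfl⟩ := hd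
  have hprog : ∀ v ∈ W, ∀ w ∈ W, RankProgress G.prio Odd R v w →
      Progress T (G.prio v) (ν v) (ν w) := by
    rintro v hv w hw ⟨h1, h2⟩
    have hp1 := G.prio_pos v
    have hp2 := G.prio_le v
    rw [hν v hv, hν w hw, Progress]
    simp only [OrdTree.ancestor, WithTop.map_coe, WithTop.coe_lt_coe, WithTop.coe_le_coe,
      OrderDual.toDual_lt_toDual, OrderDual.toDual_le_toDual, OrderDual.ofDual_toDual]
    split_ifs with hodd
    · obtain ⟨j, hj⟩ := id hodd
      have hq : e + e + 1 - 2 * levelDepth (e + e) (G.prio v) = G.prio v := by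
        unfold levelDepth; omega
      refine Or.inl ((hφ _ ?_ ?_ w hw v hv).2 ?_)
      · unfold levelDepth; omega
      · unfold levelDepth; omega
      · rw [hq]; exact h2 hodd
    · rcases Nat.eq_zero_or_pos (levelDepth (e + e) (G.prio v)) with h0 | h0
      · rw [h0]; simp
      · refine (hφ _ h0 ?_ w hw v hv).1 (rank_le_of_le hR ?_ hw hv h1)
        · unfold levelDepth; omega
        · obtain ⟨j, hj⟩ := Nat.not_odd_iff_even.1 hodd
          unfold levelDepth at h0 ⊢; omega
  have htop : ∀ p y, Progress T p ⊤ y := by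
    intro p y
    unfold Progress
    split_ifs <;> simp [OrdTree.ancestor]
  intro v
  unfold LocalCond
  by_cases hv : v ∈ W
  · split_ifs with he
    · obtain ⟨w, hw, hvw, h⟩ := hctl v hv he
      exact ⟨w, hvw, hprog v hv w hw h⟩
    · intro w hvw
      obtain ⟨hw, h⟩ := hopp v hv he w hvw
      exact hprog v hv w hw h
  · rw [hν' v hv]
    split_ifs with he
    · obtain ⟨w, hw⟩ := G.total v
      exact ⟨w, hw, htop _ _⟩
    · exact fun w _ => htop _ _

/-- Over a universal tree, some signature is finite at every vertex from which Eve wins. -/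
theorem ParityGame.EveWins.exists_isSignature {T : OrdTree (d / 2)} (hd : Even d)
    (hT : T.IsUniversal n) {v : Fin n} (hv : G.EveWins v) :
    ∃ ν, IsSignature G T ν ∧ ν v ≠ ⊤ := by
  classical
  obtain ⟨W, W₁, hW, ⟨-, R, hR, hctl, hopp⟩, h₁⟩ := exists_rankings
    (fun v w => (v, w) ∈ G.edges) G.prio Set.univ
    (fun v _ => (G.total v).imp fun w hw => ⟨Set.mem_univ _, hw⟩) (· ∈ G.eve) Odd
  have hvW : v ∈ W := (hW (Set.mem_univ v)).resolve_right
    fun h => not_eveWins_of_hasRanking h₁ h hv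
  obtain ⟨t, hsize, ht⟩ := OrdTree.exists_of_ranks (d / 2) W.toFinset
    ⟨v, Set.mem_toFinset.2 hvW⟩ (fun k => R (d + 1 - 2 * k)) fun k _ _ u hu w hw hle =>
      rank_le_of_le hR (by omega) (Set.mem_toFinset.1 hu) (Set.mem_toFinset.1 hw) hle
  obtain ⟨φ, hφ, hφR⟩ := ht T (hT t (hsize.trans (by simpa using Finset.card_le_univ W.toFinset)))
  simp only [Set.mem_toFinset] at hφ hφR
  let ψ : Fin n → T.Leaf := fun u => if hu : u ∈ W then ⟨φ u, hφ u hu⟩ else ⟨φ v, hφ v hvW⟩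
  have hψ : ∀ u ∈ W, (ψ u).1 = φ u := fun u hu => by simp [ψ, hu]
  refine ⟨fun u => if u ∈ W then (OrderDual.toDual (ψ u) : (T.Leaf)ᵒᵈ) else ⊤,
    isSignature_of_ranks (φ := ψ) hd hR hctl
      (fun u hu hc w he => hopp u hu hc w (Set.mem_univ _) he) ?_ (fun u hu => if_pos hu) (fun u hu => if_neg hu), by simp [hvW]⟩
  intro k h1 h2 u hu w hw
  rw [hψ u hu, hψ w hw]
  exact hφR k h1 h2 u hu w hw

theorem IsOutput.ne_top_iff {T : OrdTree (d / 2)} (hd : Even d) (hT : T.IsUniversal n)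
    {μ : Fin n → T.Value} (hμ : IsOutput G T μ) (v : Fin n) : μ v ≠ ⊤ ↔ G.EveWins v := by
  refine ⟨hμ.isSignature.eveWins, fun hv => ?_⟩
  obtain ⟨ν, hν, hne⟩ := hv.exists_isSignature hd hT
  exact ne_top_of_le_ne_top hne (hμ.le hν v)

end Completeness

/-! ### A calculus for machine programs -/

/-- The registers and arrays of a machine. -/
structure Store where
  reg : ℕ → ℕ
  arr : ℕ → ℕ → ℕ

/-- `Steps J c t c'`: the machine gets from `c` to `c'` in `t` steps, in the course of which the
contents of the `μ`-array change only along the relation `J`. -/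
inductive Steps (J : (ℕ → ℕ) → (ℕ → ℕ) → Prop) : Config → ℕ → Config → Prop
  | refl (c : Config) : Steps J c 0 c
  | head {c : Config} {t : ℕ} {c' : Config} : c.code ≠ [] →
      (c.step.arr muArray = c.arr muArray ∨ J (c.arr muArray) (c.step.arr muArray)) →
      Steps J c.step t c' → Steps J c (t + 1) c'

section MachineCalculus

variable {J : (ℕ → ℕ) → (ℕ → ℕ) → Prop}

theorem Steps.trans {c c' c'' : Config} {t t' : ℕ} (h : Steps J c t c') (h' : Steps J c' t' c'') :
    Steps J c (t + t') c'' := by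
  induction h with
  | refl c => rwa [Nat.zero_add]
  | head h1 h2 _ ih => rw [Nat.add_right_comm]; exact .head h1 h2 (ih h')

theorem Steps.spec {c c' : Config} {t : ℕ} (h : Steps J c t c') :
    c.after t = c' ∧ ∀ i < t, (c.after i).code ≠ [] ∧
      ((c.after (i + 1)).arr muArray = (c.after i).arr muArray ∨
        J ((c.after i).arr muArray) ((c.after (i + 1)).arr muArray)) := by
  induction h with
  | refl c => exact ⟨rfl, fun i hi => absurd hi (Nat.not_lt_zero i)⟩
  | head h1 h2 _ ih =>
    refine ⟨ih.1, fun i hi => ?_⟩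
    cases i with
    | zero => exact ⟨h1, h2⟩
    | succ i => exact ih.2 i (by omega)

variable (J) in
/-- Total correctness with running time: started in the store `s`, the code `P` terminates after
some number of steps `t` in a store `s'` such that `Q t s'`. -/
def WP (P : Program) (s : Store) (Q : ℕ → Store → Prop) : Prop :=
  ∃ t s', (∀ K, Steps J ⟨P ++ K, s.reg, s.arr⟩ t ⟨K, s'.reg, s'.arr⟩) ∧ Q t s'

variable {P P' : Program} {s : Store} {Q Q' : ℕ → Store → Prop}

theorem WP.mono (h : WP J P s Q) (hQ : ∀ t s', Q t s' → Q' t s') : WP J P s Q' := by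
  obtain ⟨t, s', h1, h2⟩ := h
  exact ⟨t, s', h1, hQ t s' h2⟩

theorem WP.nil (h : Q 0 s) : WP J [] s Q := ⟨0, s, fun _ => .refl _, h⟩

theorem WP.append (h : WP J P s fun t s' => WP J P' s' fun t' => Q (t + t')) :
    WP J (P ++ P') s Q := by
  obtain ⟨t, s', h1, t', s'', h2, h3⟩ := h
  refine ⟨t + t', s'', fun K => ?_, h3⟩
  rw [List.append_assoc]
  exact (h1 _).trans (h2 K)

/-- Code whose first step leads, without touching the `μ`-array, to the code `P'` and the store
`s'`. -/
theorem WP.step {i : Instr} {s' : Store}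
    (hstep : ∀ K, (⟨i :: K, s.reg, s.arr⟩ : Config).step = ⟨P' ++ K, s'.reg, s'.arr⟩)
    (harr : s'.arr muArray = s.arr muArray ∨ J (s.arr muArray) (s'.arr muArray))
    (h : WP J (P' ++ P) s' fun t => Q (t + 1)) : WP J (i :: P) s Q := by
  obtain ⟨t, s'', h1, h2⟩ := h
  refine ⟨t + 1, s'', fun K => .head (List.cons_ne_nil _ _) ?_ ?_, h2⟩
  · rw [List.cons_append, hstep]; exact harr
  · rw [List.cons_append, hstep, ← List.append_assoc]; exact h1 K

theorem WP.basic {i : Instr} {s' : Store} (h : WP J P s' fun t => Q (t + 1))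
    (hstep : ∀ K, (⟨i :: K, s.reg, s.arr⟩ : Config).step = ⟨K, s'.reg, s'.arr⟩)
    (harr : s'.arr muArray = s.arr muArray ∨ J (s.arr muArray) (s'.arr muArray)) :
    WP J (i :: P) s Q :=
  .step (P' := []) (by simpa using hstep) harr (by simpa using h)

theorem WP.const {x k : ℕ}
    (h : WP J P ⟨Function.update s.reg x k, s.arr⟩ fun t => Q (t + 1)) :
    WP J (.const x k :: P) s Q :=
  .basic h (fun _ => rfl) (Or.inl rfl)

theorem WP.copy {x y : ℕ}
    (h : WP J P ⟨Function.update s.reg x (s.reg y), s.arr⟩ fun t => Q (t + 1)) :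
    WP J (.copy x y :: P) s Q :=
  .basic h (fun _ => rfl) (Or.inl rfl)

theorem WP.inc {x : ℕ}
    (h : WP J P ⟨Function.update s.reg x (s.reg x + 1), s.arr⟩ fun t => Q (t + 1)) :
    WP J (.inc x :: P) s Q :=
  .basic h (fun _ => rfl) (Or.inl rfl)

theorem WP.dec {x : ℕ}
    (h : WP J P ⟨Function.update s.reg x (s.reg x - 1), s.arr⟩ fun t => Q (t + 1)) :
    WP J (.dec x :: P) s Q :=
  .basic h (fun _ => rfl) (Or.inl rfl)

theorem WP.bit {x y : ℕ}
    (h : WP J P ⟨Function.update s.reg x (s.reg y % 2), s.arr⟩ fun t => Q (t + 1)) :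
    WP J (.bit x y :: P) s Q :=
  .basic h (fun _ => rfl) (Or.inl rfl)

theorem WP.load {x a y : ℕ}
    (h : WP J P ⟨Function.update s.reg x (s.arr a (s.reg y)), s.arr⟩ fun t => Q (t + 1)) :
    WP J (.load x a y :: P) s Q :=
  .basic h (fun _ => rfl) (Or.inl rfl)

theorem WP.loadOff {x a y z : ℕ}
    (h : WP J P ⟨Function.update s.reg x (s.arr a (s.reg y + s.reg z)), s.arr⟩
      fun t => Q (t + 1)) :
    WP J (.loadOff x a y z :: P) s Q :=
  .basic h (fun _ => rfl) (Or.inl rfl)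

theorem WP.store {a y x : ℕ}
    (h : WP J P ⟨s.reg, Function.update s.arr a
      (Function.update (s.arr a) (s.reg y) (s.reg x))⟩ fun t => Q (t + 1))
    (ha : a ≠ muArray ∨ J (s.arr muArray)
      (Function.update (s.arr muArray) (s.reg y) (s.reg x))) :
    WP J (.store a y x :: P) s Q := by
  refine .basic h (fun _ => rfl) ?_
  by_cases hmu : a = muArray
  · subst hmu
    right
    simpa using ha
  · left
    simp [Function.update_of_ne (Ne.symm hmu)]

theorem WP.ite {x y : ℕ} {A B : Program}
    (h1 : s.reg x < s.reg y → WP J (A ++ P) s fun t => Q (t + 1))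
    (h2 : ¬ s.reg x < s.reg y → WP J (B ++ P) s fun t => Q (t + 1)) :
    WP J (.ite x y A B :: P) s Q := by
  by_cases h : s.reg x < s.reg y
  · exact .step (P' := A) (fun _ => by simp [Config.step, h]) (Or.inl rfl) (h1 h)
  · exact .step (P' := B) (fun _ => by simp [Config.step, h]) (Or.inl rfl) (h2 h)

theorem WP.loop_exit {x y : ℕ} {A : Program} (hlt : ¬ s.reg x < s.reg y) (h : Q 1 s) :
    WP J [.loop x y A] s Q :=
  .step (P' := []) (s' := s) (fun _ => by simp [Config.step, hlt]) (Or.inl rfl) (.nil h)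

theorem WP.loop_enter {x y : ℕ} {A : Program} (hlt : s.reg x < s.reg y)
    (h : WP J A s fun t s' => WP J [.loop x y A] s' fun t' => Q (t + t' + 1)) :
    WP J [.loop x y A] s Q :=
  .step (P' := A ++ [.loop x y A]) (s' := s) (fun _ => by simp [Config.step, hlt]) (Or.inl rfl)
    (by rw [List.append_nil]; exact .append h)

/-- While loops, with an invariant `I` and a potential `Φ` paying for the steps. -/
theorem WP.while {x y : ℕ} {A : Program} (I : Store → Prop) (Φ : Store → ℕ)
    (hbody : ∀ s, I s → s.reg x < s.reg y → WP J A s fun t s' => I s' ∧ t + 1 + Φ s' ≤ Φ s)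
    (hs : I s) :
    WP J [.loop x y A] s fun t s' => I s' ∧ ¬ s'.reg x < s'.reg y ∧ t ≤ Φ s + 1 := by
  induction h : Φ s using Nat.strong_induction_on generalizing s with
  | _ N ih =>
    subst h
    by_cases hlt : s.reg x < s.reg y
    · refine .loop_enter hlt ((hbody s hs hlt).mono fun t s' h => ?_)
      exact (ih _ (by omega) h.1 rfl).mono fun t' s'' h' => ⟨h'.1, h'.2.1, by omega⟩
    · exact .loop_exit hlt ⟨hs, hlt, by omega⟩

/-- Loops in which the register `x` runs through the positions at which the list `l` is stored; the
invariant refers to the part of the list that has been processed. -/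
theorem WP.forList {x y b c : ℕ} {A : Program} (l : List ℕ) (I : List ℕ → Store → Prop)
    (hbody : ∀ pre w post s, l = pre ++ w :: post → I pre s → s.reg x = b + pre.length →
      WP J A s fun t s' => t ≤ c ∧ I (pre ++ [w]) s' ∧ s'.reg x = s.reg x + 1 ∧ s'.reg y = s.reg y)
    (hI : I [] s) (hx : s.reg x = b) (hy : s.reg y = b + l.length) :
    WP J [.loop x y A] s fun t s' => t ≤ (c + 1) * l.length + 1 ∧ I l s' := by
  suffices H : ∀ post pre s, l = pre ++ post → I pre s → s.reg x = b + pre.length →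
      s.reg y = b + l.length →
      WP J [.loop x y A] s fun t s' => t ≤ (c + 1) * post.length + 1 ∧ I l s' from
    H l [] s rfl hI hx hy
  intro post
  induction post with
  | nil =>
    intro pre s hl hI hx hy
    rw [List.append_nil] at hl
    subst hl
    exact .loop_exit (by omega) ⟨by simp, hI⟩
  | cons w post ih =>
    intro pre s hl hI hx hy
    refine .loop_enter (by rw [hx, hy, hl]; simp) ?_
    refine (hbody pre w post s hl hI hx).mono fun t s' ⟨h1, h2, h3, h4⟩ => ?_
    refine (ih (pre ++ [w]) s' (by simpa using hl) h2 (by simp; omega) (h4.trans hy)).mono ?_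
    rintro t' s'' ⟨h5, h6⟩
    refine ⟨?_, h6⟩
    rw [List.length_cons, Nat.mul_succ]
    omega

end MachineCalculus

/-! ### The input arrays -/

theorem ParityGame.nodup_succs {n d : ℕ} (G : ParityGame n d) (v : Fin n) : (G.succs v).Nodup :=
  ((List.nodup_finRange n).filter _).map Fin.val_injective

theorem ParityGame.nodup_preds {n d : ℕ} (G : ParityGame n d) (v : Fin n) : (G.preds v).Nodup :=
  ((List.nodup_finRange n).filter _).map Fin.val_injective

theorem ParityGame.mem_preds {n d : ℕ} (G : ParityGame n d) {v : Fin n} {k : ℕ} :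
    k ∈ G.preds v ↔ ∃ u : Fin n, (u, v) ∈ G.edges ∧ u.val = k := by
  simp [ParityGame.preds]

theorem ParityGame.sum_length_succs {n d : ℕ} (G : ParityGame n d) :
    ∑ v, (G.succs v).length = G.edges.card := by
  rw [Finset.card_eq_sum_card_fiberwise (f := Prod.fst) (t := Finset.univ) fun _ _ => by simp]
  refine Finset.sum_congr rfl fun v _ => ?_
  rw [← List.toFinset_card_of_nodup (G.nodup_succs v)]
  refine Finset.card_bij' (fun k hk => (v, ⟨k, ?_⟩)) (fun e _ => e.2.val) ?_ ?_ ?_ ?_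
  · obtain ⟨w, -, rfl⟩ := G.mem_succs.1 (List.mem_toFinset.1 hk)
    exact w.2
  · intro k hk
    obtain ⟨w, hw, rfl⟩ := G.mem_succs.1 (List.mem_toFinset.1 hk)
    simpa using hw
  · rintro ⟨u, w⟩ h
    obtain ⟨h', rfl⟩ := Finset.mem_filter.1 h
    exact List.mem_toFinset.2 (G.mem_succs.2 ⟨w, h', rfl⟩)
  · intro k hk; rfl
  · rintro ⟨u, w⟩ h
    obtain ⟨h, rfl⟩ := Finset.mem_filter.1 h
    rfl

theorem ParityGame.sum_length_preds {n d : ℕ} (G : ParityGame n d) :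
    ∑ v, (G.preds v).length = G.edges.card := by
  rw [Finset.card_eq_sum_card_fiberwise (f := Prod.snd) (t := Finset.univ) fun _ _ => by simp]
  refine Finset.sum_congr rfl fun v _ => ?_
  rw [← List.toFinset_card_of_nodup (G.nodup_preds v)]
  refine Finset.card_bij' (fun k hk => (⟨k, ?_⟩, v)) (fun e _ => e.1.val) ?_ ?_ ?_ ?_
  · obtain ⟨w, -, rfl⟩ := G.mem_preds.1 (List.mem_toFinset.1 hk)
    exact w.2
  · intro k hk
    obtain ⟨w, hw, rfl⟩ := G.mem_preds.1 (List.mem_toFinset.1 hk)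
    simpa using hw
  · rintro ⟨u, w⟩ h
    obtain ⟨h', rfl⟩ := Finset.mem_filter.1 h
    exact List.mem_toFinset.2 (G.mem_preds.2 ⟨u, h', rfl⟩)
  · intro k hk; rfl
  · rintro ⟨u, w⟩ h
    obtain ⟨h, rfl⟩ := Finset.mem_filter.1 h
    rfl

theorem finRange_eq_take_append {n : ℕ} (v : Fin n) :
    List.finRange n = (List.finRange n).take v ++ v :: (List.finRange n).drop (v + 1) := by
  conv_lhs => rw [← List.take_append_drop v (List.finRange n)]
  rw [List.drop_eq_getElem_cons (by simp)]
  simp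

theorem ParityGame.startPos_succ {n : ℕ} (f : Fin n → List ℕ) (v : Fin n) :
    startPos f (v + 1) = startPos f v + (f v).length := by
  rw [startPos, List.take_succ_eq_append_getElem (by simp)]
  simp [startPos]

theorem ParityGame.concat_getD {n : ℕ} (f : Fin n → List ℕ) (v : Fin n) {pre post : List ℕ}
    {w : ℕ} (h : f v = pre ++ w :: post) :
    (concat f).getD (startPos f v + pre.length) 0 = w := by
  have h1 : concat f = ((List.finRange n).take v).flatMap f ++
      (f v ++ ((List.finRange n).drop (v + 1)).flatMap f) := by
    conv_lhs => rw [concat, finRange_eq_take_append v]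
    simp
  have h2 : startPos f v = (((List.finRange n).take v).flatMap f).length := by
    rw [startPos, List.length_flatMap]
  rw [h1, h2, h, List.getD_append_right _ _ _ _ (by omega)]
  simp

section Verification

variable {n d : ℕ} (G : ParityGame n d) (T : OrdTree (d / 2))

/-- The input arrays are intact, and the first registers hold `0`, `n` and `|T|`. -/
structure InputIntact (s : Store) : Prop where
  reg_zero : s.reg 0 = 0
  reg_two : s.reg 2 = n
  reg_three : s.reg 3 = T.size
  arr_eq : ∀ a < 10, s.arr a = initArr G T a

variable {G T} {s s' : Store}

namespace InputIntact

theorem of_frame (h : InputIntact G T s) (hreg : ∀ r < 4, s'.reg r = s.reg r)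
    (harr : ∀ a < 10, s'.arr a = s.arr a) : InputIntact G T s' where
  reg_zero := by rw [hreg 0 (by omega), h.reg_zero]
  reg_two := by rw [hreg 2 (by omega), h.reg_two]
  reg_three := by rw [hreg 3 (by omega), h.reg_three]
  arr_eq a ha := by rw [harr a ha, h.arr_eq a ha]

theorem eve (h : InputIntact G T s) (v : Fin n) : s.arr 1 v = if v ∈ G.eve then 1 else 0 := by
  rw [h.arr_eq 1 (by omega)]; simp [initArr]

theorem prio (h : InputIntact G T s) (v : Fin n) : s.arr 2 v = G.prio v := by
  rw [h.arr_eq 2 (by omega)]; simp [initArr]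

theorem succs_start (h : InputIntact G T s) (v : Fin n) :
    s.arr 3 v = ParityGame.startPos G.succs v := by
  rw [h.arr_eq 3 (by omega)]; simp [initArr, v.2.le]

theorem succs_end (h : InputIntact G T s) (v : Fin n) :
    s.arr 3 (v + 1) = ParityGame.startPos G.succs v + (G.succs v).length := by
  rw [h.arr_eq 3 (by omega), ← ParityGame.startPos_succ]
  simp [initArr]

theorem succs (h : InputIntact G T s) {v : Fin n} {pre post : List ℕ} {w : ℕ}
    (hl : G.succs v = pre ++ w :: post) :
    s.arr 4 (ParityGame.startPos G.succs v + pre.length) = w := by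
  rw [h.arr_eq 4 (by omega)]; exact ParityGame.concat_getD _ _ hl

theorem preds_start (h : InputIntact G T s) (v : Fin n) :
    s.arr 5 v = ParityGame.startPos G.preds v := by
  rw [h.arr_eq 5 (by omega)]; simp [initArr, v.2.le]

theorem preds_end (h : InputIntact G T s) (v : Fin n) :
    s.arr 5 (v + 1) = ParityGame.startPos G.preds v + (G.preds v).length := by
  rw [h.arr_eq 5 (by omega), ← ParityGame.startPos_succ]
  simp [initArr]

theorem preds (h : InputIntact G T s) {v : Fin n} {pre post : List ℕ} {w : ℕ}
    (hl : G.preds v = pre ++ w :: post) :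
    s.arr 6 (ParityGame.startPos G.preds v + pre.length) = w := by
  rw [h.arr_eq 6 (by omega)]; exact ParityGame.concat_getD _ _ hl

theorem row (h : InputIntact G T s) {p : ℕ} (hp : p ≤ d) : s.arr 7 p = p * T.size := by
  rw [h.arr_eq 7 (by omega)]; simp [initArr, hp]

theorem intervalStart (h : InputIntact G T s) {p c : ℕ} (hp : p ≤ d) (hc : c < T.size) :
    s.arr 8 (p * T.size + c) = T.intervalStart (levelDepth d p) c := by
  have h1 : (p * T.size + c) / T.size = p := by
    rw [Nat.mul_comm, Nat.mul_add_div T.size_pos, Nat.div_eq_of_lt hc, Nat.add_zero]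
  have h2 : (p * T.size + c) % T.size = c := by
    rw [Nat.mul_comm, Nat.mul_add_mod, Nat.mod_eq_of_lt hc]
  rw [h.arr_eq 8 (by omega)]; simp [initArr, hp, h1, h2]

theorem intervalEnd (h : InputIntact G T s) {p c : ℕ} (hp : p ≤ d) (hc : c < T.size) :
    s.arr 9 (p * T.size + c) = T.intervalEnd (levelDepth d p) c := by
  have h1 : (p * T.size + c) / T.size = p := by
    rw [Nat.mul_comm, Nat.mul_add_div T.size_pos, Nat.div_eq_of_lt hc, Nat.add_zero]
  have h2 : (p * T.size + c) % T.size = c := by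
    rw [Nat.mul_comm, Nat.mul_add_mod, Nat.mod_eq_of_lt hc]
  rw [h.arr_eq 9 (by omega)]; simp [initArr, hp, h1, h2]

end InputIntact

/-! ### Computing thresholds and lifts -/

/-- `r₃₂ := threshold T r₃₀ r₃₁`. -/
def thresholdCode : Program :=
  [.ite 31 3
    [.bit 33 30, .load 34 7 30, .ite 0 33 [.loadOff 32 9 34 31] [.loadOff 32 8 34 31]]
    [.copy 32 3]]

variable {J : (ℕ → ℕ) → (ℕ → ℕ) → Prop}

theorem wp_thresholdCode (hs : InputIntact G T s) (hp : s.reg 30 ≤ d) :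
    WP J thresholdCode s fun t s' => t ≤ 5 ∧ s'.arr = s.arr ∧
      s'.reg 32 = threshold T (s.reg 30) (s.reg 31) ∧ ∀ r < 32, s'.reg r = s.reg r := by
  have h0 := hs.reg_zero
  have h3 := hs.reg_three
  have hrow := hs.row hp
  refine .ite (fun h => .bit (.load (.ite (fun h' => .loadOff (.nil ?_))
    fun h' => .loadOff (.nil ?_)))) fun h => .copy (.nil ?_)
  · rw [h3] at h
    simp only [ne_eq, Nat.reduceEqDiff, not_false_eq_true, Function.update_of_ne,
      Function.update_self, h0, OfNat.zero_ne_ofNat] at h'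
    refine ⟨by omega, rfl, ?_, fun r hr => by simp (disch := omega) [Function.update_of_ne]⟩
    simp [hrow, hs.intervalEnd hp h, threshold, h, show s.reg 30 % 2 = 1 by omega]
  · rw [h3] at h
    simp only [ne_eq, Nat.reduceEqDiff, not_false_eq_true, Function.update_of_ne,
      Function.update_self, h0, OfNat.zero_ne_ofNat] at h'
    refine ⟨by omega, rfl, ?_, fun r hr => by simp (disch := omega) [Function.update_of_ne]⟩
    simp [hrow, hs.intervalStart hp h, threshold, h, show ¬ s.reg 30 % 2 = 1 by omega]
  · rw [h3] at h
    refine ⟨by omega, rfl, ?_, fun r hr => by simp (disch := omega) [Function.update_of_ne]⟩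
    simp [threshold, h, h3]

/-- Takes the successor at position `r₁₅` into account in `r₁₀` and `r₁₁` (see `scanCode`). -/
def scanEdgeCode : Program :=
  .load 20 4 15 :: .load 31 10 20 :: .copy 30 13 :: (thresholdCode ++
    [.ite 0 12 [.ite 32 10 [.copy 10 32] []] [.ite 10 32 [.copy 10 32] []],
      .ite 14 32 [] [.inc 11], .inc 15])

/-- Scans the successors of the vertex `r₅`. Afterwards `r₁₀` is the number of its lift, `r₁₁` the
number of edges at which its current value is large enough, `r₁₂` tells whether it belongs to Eve,
and `r₁₄` is the number of its current value. -/
def scanCode : Program :=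
  .load 12 1 5 :: .load 13 2 5 :: .load 14 10 5 :: .load 15 3 5 :: .copy 16 5 :: .inc 16 ::
  .load 16 3 16 :: .const 11 0 :: .ite 0 12 [.copy 10 3] [.copy 10 0] ::
  [.loop 15 16 scanEdgeCode]

variable (G T) in
/-- The number of edges from `v` at which the value of `v` is large enough. -/
def okCount (a : ℕ → ℕ) (v : Fin n) : ℕ :=
  (G.succs v).countP fun w => decide (threshold T (G.prio v) (a w) ≤ a v)

variable (G T) in
/-- The minimum or maximum, depending on the owner of `v`, of the thresholds at the neighbours in
`l`. -/
def liftFold (a : ℕ → ℕ) (v : Fin n) (l : List ℕ) : ℕ :=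
  if v ∈ G.eve then (l.map fun w => threshold T (G.prio v) (a w)).foldl min T.size
  else (l.map fun w => threshold T (G.prio v) (a w)).foldl max 0

variable (G T) in
/-- The registers while the vertex `v` is scanned, when the part `l` of its list of successors has
been processed. -/
structure Scanned (s₀ : Store) (v : Fin n) (l : List ℕ) (s : Store) : Prop where
  arr_eq : s.arr = s₀.arr
  reg_eq : ∀ r < 10, s.reg r = s₀.reg r
  reg_lift : s.reg 10 = liftFold G T (s₀.arr 10) v l
  reg_count : s.reg 11 =
    l.countP fun w => decide (threshold T (G.prio v) (s₀.arr 10 w) ≤ s₀.arr 10 v)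
  reg_eve : s.reg 12 = if v ∈ G.eve then 1 else 0
  reg_prio : s.reg 13 = G.prio v
  reg_val : s.reg 14 = s₀.arr 10 v

theorem wp_scanEdgeCode {s₀ : Store} (hs₀ : InputIntact G T s₀) {v : Fin n}
    {pre post : List ℕ} {w : ℕ} (hl : G.succs v = pre ++ w :: post)
    (h : Scanned G T s₀ v pre s)
    (hpos : s.reg 15 = ParityGame.startPos G.succs v + pre.length) :
    WP J scanEdgeCode s fun t s' => t ≤ 14 ∧ Scanned G T s₀ v (pre ++ [w]) s' ∧
      s'.reg 15 = s.reg 15 + 1 ∧ s'.reg 16 = s.reg 16 := by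
  obtain ⟨harr, hreg, hlift, hcount, heve, hprio, hval⟩ := h
  have hs : InputIntact G T s :=
    hs₀.of_frame (fun r hr => hreg r (by omega)) fun a _ => by rw [harr]
  have h0 := hs.reg_zero
  have hw : s.arr 4 (s.reg 15) = w := by rw [hpos]; exact hs.succs hl
  refine .load (.load (.copy (.append ?_)))
  refine (wp_thresholdCode (G := G) (T := T) ?_ ?_).mono ?_
  · refine hs.of_frame ?_ fun _ _ => rfl
    intro r hr; simp (disch := omega) [Function.update_of_ne]
  · simpa [hprio] using G.prio_le v
  rintro t₁ s₁ ⟨ht₁, harr₁, hout, hreg₁⟩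
  simp [hprio, hw, harr] at hout
  simp only at harr₁ hreg₁
  have g0 := hreg₁ 0 (by omega)
  have g10 := hreg₁ 10 (by omega)
  have g11 := hreg₁ 11 (by omega)
  have g12 := hreg₁ 12 (by omega)
  have g13 := hreg₁ 13 (by omega)
  have g14 := hreg₁ 14 (by omega)
  have g15 := hreg₁ 15 (by omega)
  have g16 := hreg₁ 16 (by omega)
  simp at g0 g10 g11 g12 g13 g14 g15 g16
  rw [h0] at g0
  rw [hlift] at g10
  rw [hcount] at g11
  rw [heve] at g12
  rw [hprio] at g13
  rw [hval] at g14
  have hfr : ∀ r < 10, s₁.reg r = s₀.reg r := by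
    intro r hr
    rw [hreg₁ r (by omega), ← hreg r hr]
    simp (disch := omega) [Function.update_of_ne]
  -- the minimum or maximum is updated
  suffices H : ∀ (t₂ : ℕ) (s₂ : Store), t₂ ≤ 3 → s₂.arr = s₁.arr →
      s₂.reg 10 = liftFold G T (s₀.arr 10) v (pre ++ [w]) →
      (∀ r, r ≠ 10 → s₂.reg r = s₁.reg r) →
      WP J [.ite 14 32 [] [.inc 11], .inc 15] s₂ fun t s' => t₁ + (t + t₂) + 3 ≤ 14 ∧
        Scanned G T s₀ v (pre ++ [w]) s' ∧ s'.reg 15 = s.reg 15 + 1 ∧ s'.reg 16 = s.reg 16 by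
    by_cases hv : v ∈ G.eve
    · refine .ite (fun _ => .ite (fun h2 => .copy ?_) fun h2 => ?_)
        fun h1 => absurd h1 (by simp [g0, g12, hv])
      · refine (H 3 ⟨Function.update s₁.reg 10 (s₁.reg 32), s₁.arr⟩ (by omega) rfl ?_
          fun r hr => by simp [hr]).mono fun t s' h => ?_
        · rw [hout, g10] at h2
          simp only [liftFold, hv, if_true] at h2 ⊢
          simp [hout, h2.le]
        · exact ⟨by omega, h.2⟩
      · refine (H 2 s₁ (by omega) rfl ?_ fun r hr => rfl).mono fun t s' h => ?_
        · rw [hout, g10] at h2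
          rw [g10]
          simp only [liftFold, hv, if_true] at h2 ⊢
          simp [not_lt.1 h2]
        · exact ⟨by omega, h.2⟩
    · refine .ite (fun h1 => absurd h1 (by simp [g0, g12, hv]))
        fun _ => .ite (fun h2 => .copy ?_) fun h2 => ?_
      · refine (H 3 ⟨Function.update s₁.reg 10 (s₁.reg 32), s₁.arr⟩ (by omega) rfl ?_
          fun r hr => by simp [hr]).mono fun t s' h => ?_
        · rw [hout, g10] at h2
          simp only [liftFold, hv, if_false] at h2 ⊢
          simp [hout, h2.le]
        · exact ⟨by omega, h.2⟩
      · refine (H 2 s₁ (by omega) rfl ?_ fun r hr => rfl).mono fun t s' h => ?_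
        · rw [hout, g10] at h2
          rw [g10]
          simp only [liftFold, hv, if_false] at h2 ⊢
          simp [not_lt.1 h2]
        · exact ⟨by omega, h.2⟩
  intro t₂ s₂ ht₂ harr₂ hlift₂ hreg₂
  have k14 : s₂.reg 14 = s₀.arr 10 v := by rw [hreg₂ _ (by omega), g14]
  have k32 : s₂.reg 32 = threshold T (G.prio v) (s₀.arr 10 w) := by rw [hreg₂ _ (by omega), hout]
  refine .ite (fun h => .inc (.nil ?_)) fun h => .inc (.inc (.nil ?_))
  · rw [k14, k32] at h
    refine ⟨by omega, ⟨?_, ?_, ?_, ?_, ?_, ?_, ?_⟩, ?_, ?_⟩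
    · exact harr₂.trans (harr₁.trans harr)
    · intro r hr
      simp (disch := omega) [Function.update_of_ne, hreg₂, hfr]
    · simpa using hlift₂
    · simp [hreg₂, g11, h]
    · simp [hreg₂, g12]
    · simp [hreg₂, g13]
    · simpa using k14
    · simp [hreg₂, g15]
    · simp [hreg₂, g16]
  · rw [k14, k32, not_lt] at h
    refine ⟨by omega, ⟨?_, ?_, ?_, ?_, ?_, ?_, ?_⟩, ?_, ?_⟩
    · exact harr₂.trans (harr₁.trans harr)
    · intro r hr
      simp (disch := omega) [Function.update_of_ne, hreg₂, hfr]
    · simpa using hlift₂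
    · simp [hreg₂, g11, h]
    · simp [hreg₂, g12]
    · simp [hreg₂, g13]
    · simpa using k14
    · simp [hreg₂, g15]
    · simp [hreg₂, g16]

theorem wp_scanCode (hs : InputIntact G T s) {v : Fin n} (hv : s.reg 5 = v) :
    WP J scanCode s fun t s' => t ≤ 15 * (G.succs v).length + 11 ∧
      Scanned G T s v (G.succs v) s' := by
  have h0 := hs.reg_zero
  have h3 := hs.reg_three
  have heve := hs.eve v
  have hstart := hs.succs_start v
  have hend := hs.succs_end v
  have hprio := hs.prio v
  suffices H : ∀ s₁ : Store, Scanned G T s v [] s₁ →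
      s₁.reg 15 = ParityGame.startPos G.succs v →
      s₁.reg 16 = ParityGame.startPos G.succs v + (G.succs v).length →
      WP J [.loop 15 16 scanEdgeCode] s₁ fun t s' => t + 10 ≤ 15 * (G.succs v).length + 11 ∧
        Scanned G T s v (G.succs v) s' by
    refine .load (.load (.load ?_))
    simp only [ne_eq, Nat.reduceEqDiff, not_false_eq_true, Function.update_of_ne, hv, heve, hprio]
    refine .load (.copy (.inc ?_))
    simp only [ne_eq, Nat.reduceEqDiff, not_false_eq_true, Function.update_of_ne,
      Function.update_self, Function.update_idem, hv, hstart]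
    refine .load (.const ?_)
    simp only [Function.update_self, Function.update_idem, hend]
    refine .ite (fun h => .copy ?_) fun h => .copy ?_
    · have hE : v ∈ G.eve := by
        by_contra hE
        simp [hE, h0] at h
      refine WP.mono (H _ ⟨rfl, fun r hr => ?_, ?_, ?_, ?_, ?_, ?_⟩ ?_ ?_)
        fun t s' h => ⟨by omega, h.2⟩
      · simp (disch := omega) [Function.update_of_ne]
      all_goals simp [hE, h3, liftFold]
    · have hE : v ∉ G.eve := by
        intro hE
        simp [hE, h0] at h
      refine WP.mono (H _ ⟨rfl, fun r hr => ?_, ?_, ?_, ?_, ?_, ?_⟩ ?_ ?_)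
        fun t s' h => ⟨by omega, h.2⟩
      · simp (disch := omega) [Function.update_of_ne]
      all_goals simp [hE, h0, liftFold]
  intro s₁ h1 h15 h16
  refine (WP.forList (c := 14) (G.succs v) (Scanned G T s v)
    (fun pre w post s₂ hl h2 hx => wp_scanEdgeCode hs hl h2 hx) h1 h15 h16).mono ?_
  rintro t s₂ ⟨h2, h3⟩
  exact ⟨by omega, h3⟩

/-! ### Edge counters -/

theorem threshold_mono {p c c' : ℕ} (h : c ≤ c') (h' : c' ≤ T.size) :
    threshold T p c ≤ threshold T p c' := by
  obtain ⟨y, rfl⟩ := T.exists_code_eq (h.trans h')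
  obtain ⟨y', rfl⟩ := T.exists_code_eq h'
  obtain ⟨x, hx⟩ := T.exists_code_eq (threshold_le_size T p (T.code y'))
  rw [← hx, ← progress_iff_threshold_le]
  exact Progress.mono ((progress_iff_threshold_le T p x y').2 hx.ge) (T.code_le_code.1 h)

variable (G T) in
/-- The counter of a vertex: for Eve the number of edges at which the value of the vertex is large
enough, and for Adam `1` if it is large enough at all edges and `0` otherwise. It vanishes if and
only if the vertex has to be lifted. -/
def credit (a : ℕ → ℕ) (v : Fin n) : ℕ :=
  if v ∈ G.eve then okCount G T a v else if liftCode G T a v ≤ a v then 1 else 0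

theorem liftCode_le_iff_of_mem_eve {a : ℕ → ℕ} {v : Fin n} (hv : v ∈ G.eve) :
    liftCode G T a v ≤ a v ↔ ∃ w ∈ G.succs v, threshold T (G.prio v) (a w) ≤ a v := by
  rw [liftCode, if_pos hv, foldl_min_le_iff]
  simp only [List.mem_map, exists_exists_and_eq_and]
  refine ⟨?_, Or.inr⟩
  rintro (h | h)
  · obtain ⟨w, hw⟩ := G.total v
    exact ⟨w, G.mem_succs.2 ⟨w, hw, rfl⟩, (threshold_le_size T _ _).trans h⟩
  · exact h

theorem liftCode_le_iff_of_notMem_eve {a : ℕ → ℕ} {v : Fin n} (hv : v ∉ G.eve) :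
    liftCode G T a v ≤ a v ↔ ∀ w ∈ G.succs v, threshold T (G.prio v) (a w) ≤ a v := by
  rw [liftCode, if_neg hv, foldl_max_le_iff]
  simp

theorem credit_pos_iff {a : ℕ → ℕ} {v : Fin n} :
    0 < credit G T a v ↔ liftCode G T a v ≤ a v := by
  unfold credit
  split_ifs with h1 h2
  · rw [liftCode_le_iff_of_mem_eve h1, okCount, List.countP_pos_iff]
    simp
  · simpa using h2
  · simpa using h2

theorem countP_add_of_eq_off {α : Type*} [DecidableEq α] {l : List α} (hl : l.Nodup) {v : α}
    (hv : v ∈ l) {p q : α → Bool} (hpq : ∀ w ∈ l, w ≠ v → p w = q w) :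
    l.countP q + (p v).toNat = l.countP p + (q v).toNat := by
  have hperm := List.perm_cons_erase hv
  rw [hperm.countP_eq q, hperm.countP_eq p, List.countP_cons, List.countP_cons]
  have : (l.erase v).countP p = (l.erase v).countP q := by
    refine List.countP_congr fun w hw => ?_
    have h := (hl.mem_erase_iff).1 hw
    rw [hpq w h.2 h.1]
  rw [this]
  cases p v <;> cases q v <;> simp

theorem liftCode_congr {a a' : ℕ → ℕ} {u : Fin n} (h : ∀ w ∈ G.succs u, a w = a' w) :
    liftCode G T a u = liftCode G T a' u := by
  unfold liftCode
  have : (G.succs u).map (fun w => threshold T (G.prio u) (a w)) =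
      (G.succs u).map (fun w => threshold T (G.prio u) (a' w)) :=
    List.map_congr_left fun w hw => by rw [h w hw]
  rw [this]

theorem credit_update_of_notMem {a : ℕ → ℕ} {u v : Fin n} {L : ℕ} (huv : u ≠ v)
    (h : (u, v) ∉ G.edges) : credit G T (Function.update a v L) u = credit G T a u := by
  have hu : (Function.update a (v : ℕ) L) u = a u :=
    Function.update_of_ne (fun h => huv (Fin.ext h)) _ _
  have hw : ∀ w ∈ G.succs u, (Function.update a (v : ℕ) L) w = a w := by
    intro w hw
    obtain ⟨w, hw, rfl⟩ := G.mem_succs.1 hw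
    exact Function.update_of_ne (fun h' => h (by rwa [← Fin.ext h'])) _ _
  have hc : okCount G T (Function.update a v L) u = okCount G T a u :=
    List.countP_congr fun w hw' => by rw [hw w hw', hu]
  rw [credit, credit, liftCode_congr hw, hu, hc]

/-- When the value of `v` increases, the counters of its predecessors lose the edges at which the
value of the predecessor was large enough and no longer is. -/
theorem credit_update {a : ℕ → ℕ} {u v : Fin n} {L : ℕ} (huv : u ≠ v) (h : (u, v) ∈ G.edges)
    (hL : a v ≤ L) (hLT : L ≤ T.size) :
    credit G T (Function.update a v L) u =
      if 0 < credit G T a u ∧ threshold T (G.prio u) (a v) ≤ a u ∧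
        a u < threshold T (G.prio u) L then credit G T a u - 1 else credit G T a u := by
  have hmono := threshold_mono (T := T) (p := G.prio u) hL hLT
  have hvmem : v.val ∈ G.succs u := G.mem_succs.2 ⟨v, h, rfl⟩
  have hu : (Function.update a (v : ℕ) L) u = a u :=
    Function.update_of_ne (fun h => huv (Fin.ext h)) _ _
  by_cases hE : u ∈ G.eve
  · have hcount := countP_add_of_eq_off (G.nodup_succs u) hvmem
      (p := fun w => decide (threshold T (G.prio u) (a w) ≤ a u))
      (q := fun w => decide (threshold T (G.prio u) (Function.update a (v : ℕ) L w) ≤ a u))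
      (fun w _ hw => by simp [hw])
    simp only [Function.update_self] at hcount
    simp only [credit, if_pos hE, okCount, hu]
    by_cases h1 : threshold T (G.prio u) (a v) ≤ a u
    · have hpos : 0 < (G.succs u).countP fun w => decide (threshold T (G.prio u) (a w) ≤ a u) :=
        List.countP_pos_iff.2 ⟨v, hvmem, by simpa using h1⟩
      by_cases h2 : threshold T (G.prio u) L ≤ a u
      · rw [if_neg (by omega)]
        simpa [h1, h2] using hcount
      · rw [if_pos ⟨hpos, h1, by omega⟩]
        simp [h1, h2] at hcount
        omega
    · rw [if_neg (by omega)]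
      simpa [h1, show ¬ threshold T (G.prio u) L ≤ a u by omega] using hcount
  · simp only [credit, if_neg hE, liftCode_le_iff_of_notMem_eve hE]
    simp only [hu]
    -- the edge to `v` is the only one whose threshold changes, and it does not decrease
    have hiff : (∀ w ∈ G.succs u, threshold T (G.prio u) (Function.update a (v : ℕ) L w) ≤ a u) ↔
        (∀ w ∈ G.succs u, threshold T (G.prio u) (a w) ≤ a u) ∧
          threshold T (G.prio u) L ≤ a u := by
      constructor
      · intro hcon
        have hv := hcon v hvmem
        rw [Function.update_self] at hv
        refine ⟨fun w hw => ?_, hv⟩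
        by_cases hwv : w = v
        · subst hwv; exact hmono.trans hv
        · simpa [hwv] using hcon w hw
      · rintro ⟨hall, hv⟩ w hw
        by_cases hwv : w = v
        · subst hwv; simpa using hv
        · simpa [hwv] using hall w hw
    simp only [hiff]
    by_cases hall : ∀ w ∈ G.succs u, threshold T (G.prio u) (a w) ≤ a u
    · have h1 := hall v hvmem
      by_cases h2 : threshold T (G.prio u) L ≤ a u
      · simp [h2]
      · simp [if_pos hall, h2, h1, not_le.1 h2]
    · simp [hall]

/-! ### The stack of vertices to be lifted -/

/-- Array `12` holds, below position `r₄`, the vertices satisfying `M`, each of them once. -/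
def IsStack (M : Fin n → Prop) (s : Store) : Prop :=
  ∃ S : List (Fin n), S.Nodup ∧ S.length = s.reg 4 ∧
    (∀ i (h : i < S.length), s.arr 12 i = S[i]) ∧ ∀ u, u ∈ S ↔ M u

theorem IsStack.congr {M M' : Fin n → Prop} (h : IsStack M s) (hreg : s'.reg 4 = s.reg 4)
    (harr : s'.arr 12 = s.arr 12) (hM : ∀ u, M u ↔ M' u) : IsStack M' s' := by
  obtain ⟨S, h1, h2, h3, h4⟩ := h
  exact ⟨S, h1, h2.trans hreg.symm, fun i hi => by rw [harr, h3 i hi],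
    fun u => (h4 u).trans (hM u)⟩

theorem IsStack.push {M M' : Fin n → Prop} (h : IsStack M s) {v : Fin n} (hv : ¬ M v)
    (hreg : s'.reg 4 = s.reg 4 + 1)
    (harr : s'.arr 12 = Function.update (s.arr 12) (s.reg 4) v)
    (hM : ∀ u, M' u ↔ M u ∨ u = v) : IsStack M' s' := by
  obtain ⟨S, h1, h2, h3, h4⟩ := h
  refine ⟨S ++ [v], ?_, by simp [h2, hreg], fun i hi => ?_, fun u => ?_⟩
  · refine h1.append (List.nodup_singleton v) ?_
    simpa [h4] using hv
  · rw [List.length_append, List.length_singleton] at hi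
    rw [harr]
    by_cases hi' : i < S.length
    · rw [Function.update_of_ne (by omega), h3 i hi', List.getElem_append_left hi']
    · obtain rfl : i = S.length := by omega
      rw [← h2, Function.update_self]
      simp
  · simp [h4, hM]

theorem IsStack.exists_pop {M : Fin n → Prop} (h : IsStack M s) (hpos : 0 < s.reg 4) :
    ∃ v : Fin n, s.arr 12 (s.reg 4 - 1) = v ∧ M v ∧ ∀ s' : Store, s'.reg 4 = s.reg 4 - 1 →
      s'.arr 12 = s.arr 12 → IsStack (fun u => u ≠ v ∧ M u) s' := by
  obtain ⟨S, h1, h2, h3, h4⟩ := h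
  have hne : S ≠ [] := by rintro rfl; simp at h2; omega
  rw [← List.dropLast_append_getLast hne] at h1 h4
  have hlast : S.getLast hne = S[s.reg 4 - 1]'(by omega) := by
    rw [List.getLast_eq_getElem]; simp [h2]
  refine ⟨S.getLast hne, ?_, (h4 _).1 (by simp), fun s' hreg harr => ?_⟩
  · rw [h3 _ (by omega), hlast]
  · rw [List.nodup_append] at h1
    refine ⟨S.dropLast, h1.1, by simp [h2, hreg], fun i hi => ?_, fun u => ?_⟩
    · rw [List.length_dropLast] at hi
      rw [harr, h3 i (by omega), List.getElem_dropLast]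
    · change u ∈ S.dropLast ↔ u ≠ S.getLast hne ∧ M u
      rw [← h4 u, List.mem_append, List.mem_singleton]
      constructor
      · exact fun hu => ⟨h1.2.2 u hu _ (List.mem_singleton_self _), Or.inl hu⟩
      · rintro ⟨hne', hu | hu⟩
        · exact hu
        · exact absurd hu hne'

theorem IsStack.not_of_empty {M : Fin n → Prop} (h : IsStack M s) (h0 : s.reg 4 = 0)
    (u : Fin n) : ¬ M u := by
  obtain ⟨S, h1, h2, h3, h4⟩ := h
  rw [h0, List.length_eq_zero_iff] at h2
  subst h2
  exact fun hu => List.not_mem_nil ((h4 u).2 hu)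

variable (G T) in
/-- The counters in array `11` are correct at the vertices in `D`, and the stack holds the vertices
in `D` that have to be lifted. -/
structure Tracked (D : Fin n → Prop) (s : Store) : Prop where
  intact : InputIntact G T s
  count_eq : ∀ u, D u → s.arr 11 u = credit G T (s.arr 10) u
  stack : IsStack (fun u => D u ∧ s.arr 11 u = 0) s

/-- Computes the counter of the vertex `r₅` and pushes the vertex if it has to be lifted. -/
def refreshCode : Program :=
  scanCode ++ [.ite 14 10 [.store 11 5 0, .store 12 4 5, .inc 4]
    [.ite 0 12 [] [.const 11 1], .store 11 5 11]]

theorem wp_refreshCode {D D' : Fin n → Prop} (hs : Tracked G T D s) {v : Fin n}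
    (hv : s.reg 5 = v) (hD : ¬ D v) (hD' : ∀ u, D' u ↔ D u ∨ u = v) :
    WP J refreshCode s fun t s' => t ≤ 15 * (G.succs v).length + 15 ∧ Tracked G T D' s' ∧
      s'.arr 10 = s.arr 10 ∧ s'.reg 5 = s.reg 5 := by
  refine .append ((wp_scanCode hs.intact hv).mono ?_)
  rintro t₁ s₁ ⟨ht₁, ⟨harr, hreg, hlift, hcount, heve, -, hval⟩⟩
  have h0 : s₁.reg 0 = 0 := by rw [hreg 0 (by omega), hs.intact.reg_zero]
  have h4 := hreg 4 (by omega)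
  have h5 : s₁.reg 5 = v := by rw [hreg 5 (by omega), hv]
  change s₁.reg 10 = liftCode G T (s.arr 10) v at hlift
  have hne : ∀ u : Fin n, D u → u.val ≠ v := fun u hu h => hD (by rwa [← Fin.ext h])
  -- the counter of a vertex that need not be lifted
  suffices H : ∀ (t₂ : ℕ) (s₂ : Store), t₂ ≤ 3 → s₂.arr = s₁.arr → (∀ r < 10, s₂.reg r = s.reg r) →
      0 < credit G T (s.arr 10) v → s₂.reg 11 = credit G T (s.arr 10) v →
      WP J [.store 11 5 11] s₂ fun t s' => t₁ + (t + t₂) ≤ 15 * (G.succs v).length + 15 ∧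
        Tracked G T D' s' ∧ s'.arr 10 = s.arr 10 ∧ s'.reg 5 = s.reg 5 by
    refine .ite (fun h => ?_) fun h => ?_
    · have hc : credit G T (s.arr 10) v = 0 := by
        rw [hval, hlift] at h
        by_contra hc
        exact absurd (credit_pos_iff.1 (Nat.pos_of_ne_zero hc)) (not_le.2 h)
      refine .store (.store (.inc (.nil ⟨by omega, ⟨?_, ?_, ?_⟩, ?_, ?_⟩))
        (Or.inl (by decide))) (Or.inl (by decide))
      · refine hs.intact.of_frame (fun r hr => ?_) (fun a ha => ?_)
        · simp (disch := omega) [Function.update_of_ne, hreg]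
        · simp (disch := omega) [Function.update_of_ne, harr]
      · intro u hu
        rcases (hD' u).1 hu with hu | rfl
        · simp [harr, h5, hne u hu, hs.count_eq u hu]
        · simp [harr, h5, h0, hc]
      · refine hs.stack.push (v := v) (fun h => hD h.1) (by simp [h4]) (by simp [harr, h4, h5]) ?_
        intro u
        rw [hD']
        by_cases huv : u = v
        · subst huv; simp [h5, h0]
        · have : u.val ≠ v := fun h => huv (Fin.ext h)
          simp [h5, h0, harr, huv, this]
      · simp [harr]
      · simp (disch := omega) [Function.update_of_ne, hreg]
    · have hc : 0 < credit G T (s.arr 10) v := by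
        rw [hval, hlift] at h
        exact credit_pos_iff.2 (not_lt.1 h)
      refine .ite (fun h' => ?_) fun h' => .const ?_
      · have hE : v ∈ G.eve := by
          by_contra hE
          simp [heve, hE, h0] at h'
        refine (H 2 s₁ (by omega) rfl hreg hc ?_).mono fun t s' h => ⟨by omega, h.2⟩
        rw [hcount, credit, if_pos hE]
        rfl
      · have hE : v ∉ G.eve := by
          intro hE
          simp [heve, hE, h0] at h'
        refine (H 3 ⟨Function.update s₁.reg 11 1, s₁.arr⟩ (by omega) rfl
          (fun r hr => by simp (disch := omega) [Function.update_of_ne, hreg]) hc ?_).mono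
          fun t s' h => ⟨by omega, h.2⟩
        rw [credit, if_neg hE, if_pos (credit_pos_iff.1 hc)]
        simp
  intro t₂ s₂ ht₂ harr₂ hreg₂ hc h11
  have k5 : s₂.reg 5 = v := by rw [hreg₂ 5 (by omega), hv]
  refine .store (.nil ⟨by omega, ⟨?_, ?_, ?_⟩, ?_, ?_⟩) (Or.inl (by decide))
  · refine hs.intact.of_frame (fun r hr => hreg₂ r (by omega)) (fun a ha => ?_)
    simp (disch := omega) [Function.update_of_ne, harr, harr₂]
  · intro u hu
    rcases (hD' u).1 hu with hu | rfl
    · simp [harr, harr₂, k5, hne u hu, hs.count_eq u hu]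
    · simp [harr, harr₂, k5, h11]
  · refine hs.stack.congr (hreg₂ 4 (by omega)) (by simp [harr, harr₂]) fun u => ?_
    rw [hD']
    by_cases huv : u = v
    · subst huv; simp [k5, h11, hD, hc.ne']
    · have : u.val ≠ v := fun h => huv (Fin.ext h)
      simp [k5, harr, harr₂, huv, this]
  · simp [harr, harr₂]
  · exact hreg₂ 5 (by omega)

/-! ### Informing the predecessors -/

/-- For the predecessor `r₂₀` with counter `r₂₁ > 0`: if its value `r₁₄` is large enough for the old
value `r₆` of the lifted vertex, but not for the new value `r₁₀`, its counter is decremented, and it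
is pushed if the counter becomes `0`. -/
def notifyTestCode : Program :=
  .load 30 2 20 :: .load 14 10 20 :: .copy 31 6 :: (thresholdCode ++
    [.ite 14 32 [] (.copy 31 10 :: (thresholdCode ++
      [.ite 14 32 [.dec 21, .store 11 20 21, .ite 0 21 [] [.store 12 4 20, .inc 4]] []]))])

/-- Takes care of the predecessor at position `r₁₅`. -/
def notifyEdgeCode : Program :=
  .load 20 6 15 :: .load 21 11 20 :: ([.ite 0 21 notifyTestCode []] ++ [.inc 15])

/-- Updates the counters of the predecessors of the vertex `r₅`, whose value has been raised from
`r₆` to `r₁₀`. -/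
def notifyCode : Program :=
  [.load 15 5 5, .copy 16 5, .inc 16, .load 16 5 16, .loop 15 16 notifyEdgeCode]

variable (G T) in
/-- The store while the predecessors of `v` are informed that its value has been raised to `L` from
its value in the array `a`, when the part `l` of the list of predecessors has been processed. -/
structure Notified (a : ℕ → ℕ) (v : Fin n) (L : ℕ) (l : List ℕ) (s : Store) : Prop where
  intact : InputIntact G T s
  val_eq : s.arr 10 = Function.update a v L
  reg_vertex : s.reg 5 = v
  reg_old : s.reg 6 = a v
  reg_new : s.reg 10 = L
  count_self : s.arr 11 v = 0
  count_eq : ∀ u, u ≠ v → s.arr 11 u =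
    credit G T (if u.val ∈ l then Function.update a v L else a) u
  stack : IsStack (fun u => u ≠ v ∧ s.arr 11 u = 0) s

theorem Notified.of_frame {a : ℕ → ℕ} {v : Fin n} {L : ℕ} {l l' : List ℕ}
    (h : Notified G T a v L l s) (hreg : ∀ r < 11, s'.reg r = s.reg r) (harr : s'.arr = s.arr)
    (hcredit : ∀ u, u ≠ v → credit G T (if u.val ∈ l then Function.update a v L else a) u =
      credit G T (if u.val ∈ l' then Function.update a v L else a) u) :
    Notified G T a v L l' s' where
  intact := h.intact.of_frame (fun r hr => hreg r (by omega)) fun a _ => by rw [harr]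
  val_eq := by rw [harr, h.val_eq]
  reg_vertex := by rw [hreg 5 (by omega), h.reg_vertex]
  reg_old := by rw [hreg 6 (by omega), h.reg_old]
  reg_new := by rw [hreg 10 (by omega), h.reg_new]
  count_self := by rw [harr, h.count_self]
  count_eq u hu := by rw [harr, h.count_eq u hu, hcredit u hu]
  stack := h.stack.congr (hreg 4 (by omega)) (by rw [harr]) fun u => by rw [harr]

theorem wp_notifyTestCode {a : ℕ → ℕ} {u v : Fin n} {L : ℕ} {pre : List ℕ} (huv : u ≠ v)
    (hedge : (u, v) ∈ G.edges) (hL : a v ≤ L) (hLT : L ≤ T.size) (hu : u.val ∉ pre)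
    (h : Notified G T a v L pre s) (h20 : s.reg 20 = u) (h21 : s.reg 21 = s.arr 11 u)
    (hpos : 0 < s.arr 11 u) :
    WP J notifyTestCode s fun t s' => t ≤ 21 ∧ Notified G T a v L (pre ++ [u.val]) s' ∧
      s'.reg 15 = s.reg 15 ∧ s'.reg 16 = s.reg 16 := by
  have hcredit : credit G T a u = s.arr 11 u := by
    rw [h.count_eq u huv, if_neg hu]
  have hupd := credit_update (G := G) (T := T) (a := a) huv hedge hL hLT
  rw [hcredit] at hupd
  have hau : Function.update a (v : ℕ) L u = a u :=
    Function.update_of_ne (fun h => huv (Fin.ext h)) _ _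
  -- nothing has to be done if the counter is already correct
  have hskip : ∀ s₁ : Store, (∀ r < 11, s₁.reg r = s.reg r) → s₁.arr = s.arr →
      credit G T (Function.update a v L) u = credit G T a u →
      Notified G T a v L (pre ++ [u.val]) s₁ := by
    intro s₁ hreg harr heq
    refine h.of_frame hreg harr fun w hw => ?_
    by_cases hwu : w = u
    · subst hwu; simp [hu, heq]
    · have : w.val ≠ u := fun h => hwu (Fin.ext h)
      simp [this]
  refine .load (.load (.copy ?_))
  simp only [ne_eq, Nat.reduceEqDiff, not_false_eq_true, Function.update_of_ne, h20,
    h.intact.prio u, h.val_eq, hau, h.reg_old]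
  refine .append ?_
  refine WP.mono (wp_thresholdCode (G := G) (T := T) ?_ ?_) ?_
  · refine h.intact.of_frame (fun r hr => ?_) fun _ _ => rfl
    simp (disch := omega) [Function.update_of_ne]
  · simpa using G.prio_le u
  rintro t₁ s₁ ⟨ht₁, harr₁, hout₁, hreg₁⟩
  simp at hout₁
  have k14 : s₁.reg 14 = a u := by rw [hreg₁ 14 (by omega)]; simp
  have k30 : s₁.reg 30 = G.prio u := by rw [hreg₁ 30 (by omega)]; simp
  have kfr : ∀ r < 11, s₁.reg r = s.reg r := by
    intro r hr
    rw [hreg₁ r (by omega)]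
    simp (disch := omega) [Function.update_of_ne]
  have k15 : s₁.reg 15 = s.reg 15 := by rw [hreg₁ 15 (by omega)]; simp
  have k16 : s₁.reg 16 = s.reg 16 := by rw [hreg₁ 16 (by omega)]; simp
  have k20 : s₁.reg 20 = u := by rw [hreg₁ 20 (by omega)]; simp [h20]
  have k21 : s₁.reg 21 = s.arr 11 u := by rw [hreg₁ 21 (by omega)]; simp [h21]
  clear hreg₁
  change s₁.arr = s.arr at harr₁
  refine .ite (fun h1 => .nil ⟨by omega, hskip s₁ kfr harr₁ ?_, k15, k16⟩) fun h1 => .copy ?_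
  · rw [k14, hout₁] at h1
    rw [hupd, if_neg (by omega), hcredit]
  rw [k14, hout₁, not_lt] at h1
  change WP _ ((thresholdCode ++ _) ++ []) _ _
  rw [List.append_nil]
  refine .append ?_
  refine WP.mono (wp_thresholdCode (G := G) (T := T) ?_ ?_) ?_
  · refine h.intact.of_frame (fun r hr => ?_) fun _ _ => by rw [harr₁]
    simp (disch := omega) [Function.update_of_ne, kfr]
  · simpa [k30] using G.prio_le u
  rintro t₂ s₂ ⟨ht₂, harr₂, hout₂, hreg₂⟩
  simp [k30, kfr, h.reg_new] at hout₂
  have j14 : s₂.reg 14 = a u := by rw [hreg₂ 14 (by omega)]; simp [k14]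
  have jfr : ∀ r < 11, s₂.reg r = s.reg r := by
    intro r hr
    rw [hreg₂ r (by omega)]
    simp (disch := omega) [Function.update_of_ne, kfr]
  have j15 : s₂.reg 15 = s.reg 15 := by rw [hreg₂ 15 (by omega)]; simp [k15]
  have j16 : s₂.reg 16 = s.reg 16 := by rw [hreg₂ 16 (by omega)]; simp [k16]
  have j20 : s₂.reg 20 = u := by rw [hreg₂ 20 (by omega)]; simp [k20]
  have j21 : s₂.reg 21 = s.arr 11 u := by rw [hreg₂ 21 (by omega)]; simp [k21]
  clear hreg₂
  change s₂.arr = s₁.arr at harr₂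
  rw [harr₁] at harr₂
  refine .ite (fun h2 => ?_) fun h2 => .nil ⟨by omega, hskip s₂ jfr harr₂ ?_, j15, j16⟩
  swap
  · rw [j14, hout₂] at h2
    rw [hupd, if_neg (by omega), hcredit]
  rw [j14, hout₂] at h2
  rw [if_pos ⟨hpos, h1, h2⟩] at hupd
  have hne : ∀ w : Fin n, w ≠ u → w.val ≠ u := fun w hw h => hw (Fin.ext h)
  -- the counter has to be decremented
  have hnew : ∀ s₃ : Store, (∀ r < 11, r ≠ 4 → s₃.reg r = s.reg r) →
      (∀ b < 11, s₃.arr b = s.arr b) →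
      s₃.arr 11 = Function.update (s.arr 11) u (s.arr 11 u - 1) →
      IsStack (fun w => w ≠ v ∧ s₃.arr 11 w = 0) s₃ →
      Notified G T a v L (pre ++ [u.val]) s₃ := by
    intro s₃ hreg₃ harr₃ hcount hstack
    refine ⟨h.intact.of_frame (fun r hr => hreg₃ r (by omega) (by omega))
      (fun b hb => harr₃ b (by omega)), ?_, ?_, ?_, ?_, ?_, ?_, hstack⟩
    · rw [harr₃ 10 (by omega), h.val_eq]
    · rw [hreg₃ 5 (by omega) (by omega), h.reg_vertex]
    · rw [hreg₃ 6 (by omega) (by omega), h.reg_old]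
    · rw [hreg₃ 10 (by omega) (by omega), h.reg_new]
    · rw [hcount, Function.update_of_ne (hne v huv.symm), h.count_self]
    · intro w hw
      by_cases hwu : w = u
      · subst hwu; simp [hcount, hupd]
      · rw [hcount, Function.update_of_ne (hne w hwu), h.count_eq w hw]
        simp [hne w hwu]
  refine .dec (.store ?_ (Or.inl (by decide)))
  refine .ite (fun h3 => .nil ⟨by omega, hnew _ ?_ ?_ ?_ ?_, ?_, ?_⟩)
    fun h3 => .store (.inc (.nil ⟨by omega, hnew _ ?_ ?_ ?_ ?_, ?_, ?_⟩)) (Or.inl (by decide))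
  · intro r hr _; simp (disch := omega) [Function.update_of_ne, jfr]
  · intro b hb; simp (disch := omega) [Function.update_of_ne, harr₂]
  · simp [j20, j21, harr₂]
  · have h3' : 0 < s.arr 11 u - 1 := by simpa [j21, jfr, h.intact.reg_zero] using h3
    refine h.stack.congr ?_ (by simp [harr₂]) fun w => ?_
    · simp [jfr]
    · by_cases hwu : w = u
      · subst hwu; simp [j20, j21]; omega
      · simp [j20, harr₂, hne w hwu]
  · simp [j15]
  · simp [j16]
  · intro r hr _; simp (disch := omega) [Function.update_of_ne, jfr]
  · intro b hb; simp (disch := omega) [Function.update_of_ne, harr₂]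
  · simp [j20, j21, harr₂]
  · have h3' : s.arr 11 u ≤ 1 := by simpa [j21, jfr, h.intact.reg_zero] using h3
    replace h3' : s.arr 11 u - 1 = 0 := by omega
    refine h.stack.push (v := u) (fun h => hpos.ne' h.2) ?_ ?_ fun w => ?_
    · simp [jfr]
    · simp [j20, jfr, harr₂]
    · by_cases hwu : w = u
      · subst hwu; simp [j20, j21, h3', huv]
      · simp [j20, harr₂, hne w hwu, hwu]
  · simp [j15]
  · simp [j16]

theorem wp_notifyEdgeCode {a : ℕ → ℕ} {v : Fin n} {L : ℕ} (hL : a v ≤ L) (hLT : L ≤ T.size)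
    {pre post : List ℕ} {k : ℕ} (hl : G.preds v = pre ++ k :: post)
    (h : Notified G T a v L pre s)
    (hpos : s.reg 15 = ParityGame.startPos G.preds v + pre.length) :
    WP J notifyEdgeCode s fun t s' => t ≤ 25 ∧ Notified G T a v L (pre ++ [k]) s' ∧
      s'.reg 15 = s.reg 15 + 1 ∧ s'.reg 16 = s.reg 16 := by
  have hk : s.arr 6 (s.reg 15) = k := by rw [hpos]; exact h.intact.preds hl
  obtain ⟨u, hedge, rfl⟩ := G.mem_preds.1 (show k ∈ G.preds v by rw [hl]; simp)
  have hu : u.val ∉ pre := by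
    have := G.nodup_preds v
    rw [hl, List.nodup_append] at this
    exact fun hmem => this.2.2 _ hmem _ List.mem_cons_self rfl
  refine .load (.load ?_)
  simp only [Function.update_self, hk]
  refine .append ?_
  suffices H : WP J [.ite 0 21 notifyTestCode []]
      ⟨Function.update (Function.update s.reg 20 u) 21 (s.arr 11 u), s.arr⟩ fun t s' => t ≤ 22 ∧
        Notified G T a v L (pre ++ [u.val]) s' ∧ s'.reg 15 = s.reg 15 ∧ s'.reg 16 = s.reg 16 by
    refine H.mono ?_
    rintro t s₁ ⟨ht, h1, h15, h16⟩
    refine .inc (.nil ⟨by omega, ?_, by simp [h15], by simp [h16]⟩)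
    refine h1.of_frame (fun r hr => ?_) rfl fun _ _ => rfl
    simp (disch := omega) [Function.update_of_ne]
  refine .ite (fun h1 => ?_) fun h1 => .nil ⟨by omega, ?_, by simp, by simp⟩
  · have h1' : 0 < s.arr 11 u := by simpa [h.intact.reg_zero] using h1
    have huv : u ≠ v := by
      rintro rfl
      exact h1'.ne' h.count_self
    rw [List.append_nil]
    refine WP.mono (wp_notifyTestCode huv hedge hL hLT hu (h.of_frame (fun r hr => ?_) rfl
      fun _ _ => rfl) ?_ ?_ ?_) fun t s' h => ⟨by omega, h.2.1, ?_, ?_⟩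
    · simp (disch := omega) [Function.update_of_ne]
    · simp
    · simp
    · exact h1'
    · rw [h.2.2.1]; simp
    · rw [h.2.2.2]; simp
  · have h1' : s.arr 11 u = 0 := by simpa [h.intact.reg_zero] using h1
    refine h.of_frame (fun r hr => ?_) rfl fun w hw => ?_
    · simp (disch := omega) [Function.update_of_ne]
    · by_cases hwu : w = u
      · subst hwu
        have hcredit : credit G T a w = 0 := by
          rw [← h1', h.count_eq w hw, if_neg hu]
        have hupd := credit_update (G := G) (T := T) (a := a) hw hedge hL hLT
        simp [hcredit] at hupd
        simp [hu, hupd, hcredit]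
      · have : w.val ≠ u := fun h => hwu (Fin.ext h)
        simp [this]

theorem wp_notifyCode {a : ℕ → ℕ} {v : Fin n} {L : ℕ} (hL : a v ≤ L) (hLT : L ≤ T.size)
    (h : Notified G T a v L [] s) :
    WP J notifyCode s fun t s' => t ≤ 26 * (G.preds v).length + 5 ∧
      Tracked G T (fun u => u ≠ v) s' ∧ s'.arr 10 = Function.update a v L ∧ s'.reg 5 = v := by
  have h5 := h.reg_vertex
  refine .load (.copy (.inc (.load ?_)))
  simp only [ne_eq, Nat.reduceEqDiff, not_false_eq_true, Function.update_of_ne,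
    Function.update_self, Function.update_idem, h5, h.intact.preds_start, h.intact.preds_end]
  refine WP.mono (WP.forList (b := ParityGame.startPos G.preds v) (c := 25) (G.preds v)
    (Notified G T a v L) (fun pre k post s₂ hl h2 hx => wp_notifyEdgeCode hL hLT hl h2 hx)
    (h.of_frame (fun r hr => ?_) rfl fun _ _ => rfl) (by simp) (by simp)) ?_
  · simp (disch := omega) [Function.update_of_ne]
  rintro t s₁ ⟨ht, h1⟩
  refine ⟨by omega, ⟨h1.intact, fun u hu => ?_, h1.stack⟩, h1.val_eq, h1.reg_vertex⟩
  rw [h1.count_eq u hu, h1.val_eq]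
  split_ifs with hmem
  · rfl
  · rw [credit_update_of_notMem hu]
    exact fun hedge => hmem (G.mem_preds.2 ⟨u, hedge, rfl⟩)

/-! ### The whole program -/

/-- Pops a vertex, lifts it, informs its predecessors, and computes its counter. -/
def liftingCode : Program :=
  .dec 4 :: .load 5 12 4 :: (scanCode ++ .copy 6 14 :: .store 10 5 10 ::
    (notifyCode ++ refreshCode))

/-- An implementation of value iteration. Array `11` holds the counters, array `12` the stack,
register `4` the height of the stack. -/
def valueIteration : Program :=
  .load 2 0 0 :: .const 8 3 :: .load 3 0 8 :: ([.loop 5 2 (refreshCode ++ [.inc 5])] ++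
    [.loop 0 4 liftingCode])

variable (G T) in
/-- One iteration of the algorithm, on the numbers of the values. -/
def LiftsTo (a a' : ℕ → ℕ) : Prop :=
  ∃ v : Fin n, a v < liftCode G T a v ∧ a' = Function.update a v (liftCode G T a v)

theorem wp_liftingCode (hs : Tracked G T (fun _ => True) s) (hpos : 0 < s.reg 4) :
    WP (LiftsTo G T) liftingCode s fun t s' => Tracked G T (fun _ => True) s' ∧
      ∃ v : Fin n, t ≤ 30 * (G.succs v).length + 26 * (G.preds v).length + 35 ∧
        s.arr 10 v < liftCode G T (s.arr 10) v ∧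
        s'.arr 10 = Function.update (s.arr 10) v (liftCode G T (s.arr 10) v) := by
  obtain ⟨v, hv, ⟨-, hcount⟩, hpop⟩ := hs.stack.exists_pop hpos
  have hlt : s.arr 10 v < liftCode G T (s.arr 10) v := by
    rw [hs.count_eq v trivial] at hcount
    by_contra hle
    exact (credit_pos_iff.2 (not_lt.1 hle)).ne' hcount
  have hLT := liftCode_le_size (G := G) (T := T) (s.arr 10) v
  refine .dec (.load ?_)
  simp only [Function.update_self, hv]
  refine .append ?_
  refine WP.mono (wp_scanCode (G := G) (T := T) (v := v) ?_ ?_) ?_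
  · refine hs.intact.of_frame (fun r hr => ?_) fun _ _ => rfl
    simp (disch := omega) [Function.update_of_ne]
  · simp
  rintro t₁ s₁ ⟨ht₁, ⟨harr, hreg, hlift, -, -, -, hval⟩⟩
  change s₁.reg 10 = liftCode G T (s.arr 10) v at hlift
  simp only at harr hreg hval
  have h5 : s₁.reg 5 = v := by rw [hreg 5 (by omega)]; simp
  have h4 : s₁.reg 4 = s.reg 4 - 1 := by rw [hreg 4 (by omega)]; simp
  refine .copy (.store ?_ (Or.inr ?_))
  swap
  · refine ⟨v, ?_, ?_⟩
    · simpa [harr, muArray] using hlt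
    · simp [harr, h5, hlift, muArray]
  refine .append ?_
  refine WP.mono (wp_notifyCode (G := G) (T := T) (a := s.arr 10) (v := v)
    (L := liftCode G T (s.arr 10) v) hlt.le hLT ⟨?_, ?_, ?_, ?_, ?_, ?_, ?_, ?_⟩) ?_
  · refine hs.intact.of_frame (fun r hr => ?_) fun b hb => ?_
    · simp (disch := omega) [Function.update_of_ne, hreg]
    · simp (disch := omega) [Function.update_of_ne, harr]
  · simp [harr, h5, hlift]
  · simp [h5]
  · simp [hval]
  · simp [hlift]
  · simp [harr, hcount]
  · intro u hu
    simp [harr, hs.count_eq u trivial]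
  · refine (hpop _ ?_ ?_).congr (s := ⟨Function.update s₁.reg 6 0, s₁.arr⟩) ?_ ?_ fun u => ?_
    · simp [h4]
    · simp [harr]
    · simp
    · simp
    · simp [harr]
  rintro t₂ s₂ ⟨ht₂, hs₂, hval₂, h5₂⟩
  refine (wp_refreshCode (D' := fun _ => True) hs₂ h5₂ (by simp) (fun u => by simp [em'])).mono ?_
  rintro t₃ s₃ ⟨ht₃, hs₃, hval₃, -⟩
  exact ⟨hs₃, v, by omega, hlt, hval₃.trans hval₂⟩

variable (G) in
/-- A bound for the time that one lift of `v` takes. -/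
def liftCost (v : Fin n) : ℕ := 30 * (G.succs v).length + 26 * (G.preds v).length + 36

theorem sum_liftCost_le : ∑ v, liftCost G v ≤ 92 * G.edges.card := by
  have hn : n ≤ G.edges.card := by
    rw [← G.sum_length_succs]
    have : ∑ _v : Fin n, 1 ≤ ∑ v, (G.succs v).length := by
      refine Finset.sum_le_sum fun v _ => ?_
      obtain ⟨w, hw⟩ := G.total v
      exact List.length_pos_of_mem (G.mem_succs.2 ⟨w, hw, rfl⟩)
    simpa using this
  simp only [liftCost, Finset.sum_add_distrib, ← Finset.mul_sum, G.sum_length_succs,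
    G.sum_length_preds]
  simp
  omega

/-- A potential drops by the weight of `v` if the factor of `v` decreases. -/
theorem add_sum_mul_le {w c c' : Fin n → ℕ} (v : Fin n) (hv : c' v < c v)
    (h : ∀ u, u ≠ v → c' u ≤ c u) : w v + ∑ u, w u * c' u ≤ ∑ u, w u * c u := by
  rw [← Finset.add_sum_erase _ _ (Finset.mem_univ v),
    ← Finset.add_sum_erase _ _ (Finset.mem_univ v), ← Nat.add_assoc]
  refine Nat.add_le_add ?_ (Finset.sum_le_sum fun u hu =>
    Nat.mul_le_mul_left _ (h u (Finset.ne_of_mem_erase hu)))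
  calc w v + w v * c' v = w v * (c' v + 1) := by ring
    _ ≤ w v * c v := Nat.mul_le_mul_left _ hv

theorem wp_initLoop (hs : InputIntact G T s) (h4 : s.reg 4 = 0) (h5 : s.reg 5 = 0) :
    WP J [.loop 5 2 (refreshCode ++ [.inc 5])] s fun t s' =>
      t ≤ (∑ v, liftCost G v) + 1 ∧ Tracked G T (fun _ => True) s' ∧ s'.arr 10 = s.arr 10 := by
  refine (WP.while (fun s' => Tracked G T (fun u => u.val < s'.reg 5) s' ∧ s'.arr 10 = s.arr 10)
    (fun s' => ∑ v, liftCost G v * if s'.reg 5 ≤ v then 1 else 0) ?_ ⟨⟨hs, ?_, ?_⟩, rfl⟩).mono ?_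
  · rintro s₁ ⟨h1, hval⟩ hlt
    rw [h1.intact.reg_two] at hlt
    refine .append ((wp_refreshCode h1 (v := ⟨s₁.reg 5, hlt⟩) rfl (by simp)
      (D' := fun u => u.val < s₁.reg 5 + 1) (fun u => ?_)).mono ?_)
    · rw [Fin.ext_iff]; simp only; omega
    rintro t s₂ ⟨ht, h2, hval₂, h5₂⟩
    refine .inc (.nil ⟨⟨⟨?_, ?_, ?_⟩, ?_⟩, ?_⟩)
    · refine h2.intact.of_frame (fun r hr => ?_) fun _ _ => rfl
      simp (disch := omega) [Function.update_of_ne]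
    · intro u hu
      exact h2.count_eq u (by simpa [h5₂] using hu)
    · refine h2.stack.congr (by simp) rfl fun u => ?_
      simp [h5₂]
    · exact hval₂.trans hval
    · have := add_sum_mul_le (w := liftCost G) (c := fun v => if s₁.reg 5 ≤ v then 1 else 0)
        (c' := fun v => if s₁.reg 5 + 1 ≤ v then 1 else 0) ⟨s₁.reg 5, hlt⟩ (by simp)
        (fun u _ => by split_ifs <;> omega)
      simp only [Function.update_self, h5₂] at this ⊢
      refine le_trans (Nat.add_le_add_right ?_ _) this
      unfold liftCost
      omega
  · intro u hu
    omega
  · refine ⟨[], List.nodup_nil, h4.symm, fun i hi => absurd hi (Nat.not_lt_zero i), fun u => ?_⟩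
    simp [h5]
  · rintro t s' ⟨⟨h1, hval⟩, hexit, ht⟩
    have hall : ∀ u : Fin n, u.val < s'.reg 5 := by
      intro u
      rw [h1.intact.reg_two] at hexit
      omega
    refine ⟨?_, ⟨h1.intact, fun u _ => h1.count_eq u (hall u), ?_⟩, hval⟩
    · simpa [h5] using ht
    · exact h1.stack.congr rfl rfl fun u => by simp [hall u]

theorem wp_mainLoop (hs : Tracked G T (fun _ => True) s) :
    WP (LiftsTo G T) [.loop 0 4 liftingCode] s fun t s' =>
      t ≤ (∑ v, liftCost G v) * T.size + 1 ∧
        ∀ v : Fin n, liftCode G T (s'.arr 10) v ≤ s'.arr 10 v := by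
  refine (WP.while (Tracked G T (fun _ => True))
    (fun s' => ∑ v, liftCost G v * (T.size - s'.arr 10 v)) ?_ hs).mono ?_
  · intro s₁ h1 hlt
    rw [h1.intact.reg_zero] at hlt
    refine (wp_liftingCode h1 hlt).mono ?_
    rintro t s₂ ⟨h2, v, ht, hv, hval⟩
    refine ⟨h2, ?_⟩
    have hLT := liftCode_le_size (G := G) (T := T) (s₁.arr 10) v
    have := add_sum_mul_le (w := liftCost G) (c := fun v => T.size - s₁.arr 10 v)
      (c' := fun v => T.size - s₂.arr 10 v) v (by simp only [hval, Function.update_self]; omega)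
      (fun u hu => by
        rw [hval, Function.update_of_ne fun h => hu (Fin.ext h)])
    refine le_trans (Nat.add_le_add_right ?_ _) this
    unfold liftCost
    omega
  · rintro t s' ⟨h1, hexit, ht⟩
    refine ⟨ht.trans (Nat.add_le_add_right ?_ _), fun v => ?_⟩
    · rw [Finset.sum_mul]
      exact Finset.sum_le_sum fun v _ => Nat.mul_le_mul_left _ (Nat.sub_le _ _)
    · rw [h1.intact.reg_zero] at hexit
      have hne := h1.stack.not_of_empty (by omega) v
      rw [← credit_pos_iff, ← h1.count_eq v trivial]
      exact Nat.pos_of_ne_zero fun h => hne ⟨trivial, h⟩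

variable (G T) in
theorem wp_valueIteration :
    WP (LiftsTo G T) valueIteration ⟨fun _ => 0, initArr G T⟩ fun t s' =>
      t ≤ (∑ v, liftCost G v) * (T.size + 1) + 5 ∧
        ∀ v : Fin n, liftCode G T (s'.arr 10) v ≤ s'.arr 10 v := by
  refine .load (.const (.load (.append ?_)))
  refine WP.mono (wp_initLoop (G := G) (T := T) ⟨?_, ?_, ?_, fun _ _ => rfl⟩ ?_ ?_) ?_
  · simp
  · simp [initArr]
  · simp [initArr]
  · simp
  · simp
  rintro t₁ s₁ ⟨ht₁, h1, -⟩
  refine (wp_mainLoop h1).mono ?_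
  rintro t₂ s₂ ⟨ht₂, h2⟩
  refine ⟨?_, h2⟩
  rw [Nat.mul_succ]
  omega

theorem Represents.eq {a : ℕ → ℕ} {μ ν : Fin n → T.Value} (hμ : Represents T a μ)
    (hν : Represents T a ν) : μ = ν :=
  funext fun v => T.code_injective ((hμ v).symm.trans (hν v))

theorem LiftsTo.loopStep {a a' : ℕ → ℕ} {μ ν : Fin n → T.Value} (h : LiftsTo G T a a')
    (hμ : Represents T a μ) (hν : Represents T a' ν) : LoopStep G T μ ν := by
  obtain ⟨v, hv, rfl⟩ := h
  refine ⟨v, fun heq => ?_, ?_⟩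
  · rw [← hμ.code_lift, ← heq, hμ v] at hv
    exact lt_irrefl _ hv
  · refine hν.eq fun u => ?_
    by_cases huv : u = v
    · subst huv; simp [hμ.code_lift]
    · have : u.val ≠ v := fun h => huv (Fin.ext h)
      simp [this, huv, hμ u]

theorem exists_executesValueIteration (G : ParityGame n d) (T : OrdTree (d / 2)) :
    ∃ t μ, ExecutesValueIteration valueIteration G T t μ ∧ IsOutput G T μ ∧
      t ≤ (∑ v, liftCost G v) * (T.size + 1) + 5 := by
  obtain ⟨t, s', hsteps, ht, hfinal⟩ := wp_valueIteration G T
  have hsteps := hsteps []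
  rw [List.append_nil] at hsteps
  obtain ⟨hend, htrace⟩ := hsteps.spec
  change (initConfig valueIteration G T).after t = _ at hend
  change ∀ i < t, ((initConfig valueIteration G T).after i).code ≠ [] ∧
    (((initConfig valueIteration G T).after (i + 1)).arr muArray =
      ((initConfig valueIteration G T).after i).arr muArray ∨
      LiftsTo G T (((initConfig valueIteration G T).after i).arr muArray)
        (((initConfig valueIteration G T).after (i + 1)).arr muArray)) at htrace
  set A : ℕ → ℕ → ℕ := fun i => ((initConfig valueIteration G T).after i).arr muArray with hA
  have hvalid : ∀ i ≤ t, ∀ v : Fin n, A i v ≤ T.size := by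
    intro i
    induction i with
    | zero => exact fun _ v => Nat.zero_le _
    | succ i ih =>
      intro hi v
      rcases (htrace i hi).2 with h | ⟨u, -, h⟩
      · exact (congrFun h v).trans_le (ih (by omega) v)
      · refine (congrFun h v).trans_le ?_
        by_cases huv : v = u
        · subst huv; rw [Function.update_self]; exact liftCode_le_size _ _
        · rw [Function.update_of_ne fun h => huv (Fin.ext h)]
          exact ih (by omega) v
  have hrep : ∀ i, ∃ μ : Fin n → T.Value, i ≤ t → Represents T (A i) μ := by
    intro i
    by_cases hi : i ≤ t
    · choose μ hμ using fun v => T.exists_code_eq (hvalid i hi v)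
      exact ⟨μ, fun _ v => (hμ v).symm⟩
    · exact ⟨fun _ => ⊤, fun h => absurd h hi⟩
  choose r hr using hrep
  have h0 : r 0 = fun _ => leafMin T :=
    (hr 0 (Nat.zero_le _)).eq fun v => by rw [code_leafMin]; rfl
  have hstep : ∀ i < t, r (i + 1) = r i ∨ LoopStep G T (r i) (r (i + 1)) := by
    intro i hi
    rcases (htrace i hi).2 with h | h
    · left
      refine (hr (i + 1) hi).eq fun v => ?_
      exact (congrFun h v).trans (hr i hi.le v)
    · exact Or.inr (h.loopStep (hr i hi.le) (hr (i + 1) hi))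
  have hreach : ∀ i ≤ t, Relation.ReflTransGen (LoopStep G T) (fun _ => leafMin T) (r i) ∧
      ∀ v, r i v ≤ lift G T (r i) v := by
    intro i
    induction i with
    | zero => intro _; rw [h0]; exact ⟨.refl, fun v => leafMin_le _⟩
    | succ i ih =>
      intro hi
      obtain ⟨h1, h2⟩ := ih (by omega)
      rcases hstep i hi with h | h
      · rw [h]; exact ⟨h1, h2⟩
      · exact ⟨h1.tail h, (h.le_lift h2).2⟩
  obtain ⟨h1, h2⟩ := hreach t le_rfl
  have hAt : A t = s'.arr 10 := by simp only [hA, hend]; rfl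
  have hfix : ∀ v, r t v = lift G T (r t) v := by
    intro v
    refine le_antisymm (h2 v) ?_
    rw [← T.code_le_code, (hr t le_rfl).code_lift, ← hr t le_rfl v, hAt]
    exact hfinal v
  exact ⟨t, r t, ⟨fun i hi => (htrace i hi).1, by rw [hend], r, h0, hstep,
    fun i hi v => hr i hi v, rfl, hfix⟩, ⟨h1, hfix⟩, ht⟩

end Verification

end ParityVI

open ParityVI in
theorem mainTheorem3 :
    ∃ (P : Program) (C : ℝ), ∀ (n d : ℕ), Even d → ∀ T : OrdTree (d / 2), T.IsUniversal n →
      ∀ G : ParityGame n d,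
        (∀ (k : ℕ) (r : ℕ → Fin n → T.Value), r 0 = (fun _ => leafMin T) →
          (∀ i < k, LoopStep G T (r i) (r (i + 1))) → k ≤ n * T.size) ∧
        ∃ μ : Fin n → T.Value,
          (∀ μ' : Fin n → T.Value, IsOutput G T μ' ↔ μ' = μ) ∧
          IsSignature G T μ ∧
          (∀ v : Fin n, μ v ≠ ⊤ ↔ G.EveWins v) ∧
          (0 < n → ∃ t : ℕ, ExecutesValueIteration P G T t μ ∧
            (t : ℝ) ≤ C * (G.edges.card * max 1 (Real.logb 2 n) * Real.logb 2 d * T.size)) := by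
  -- the time is at most `92 m (|T| + 1) + 5 ≤ 189 m |T|`; both logarithmic factors are at least `1`
  refine ⟨valueIteration, 189, fun n d hd T hT G => ⟨fun k r => loop_run_le, ?_⟩⟩
  obtain ⟨t, μ, hexec, hμ, ht⟩ := exists_executesValueIteration G T
  refine ⟨μ, fun μ' => ⟨fun h => h.eq hμ, fun h => h ▸ hμ⟩, hμ.isSignature, hμ.ne_top_iff hd hT,
    fun hn => ⟨t, hexec, ?_⟩⟩
  have hd2 : 2 ≤ d := by
    have h1 := G.prio_pos ⟨0, hn⟩
    have h2 := G.prio_le ⟨0, hn⟩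
    obtain ⟨e, rfl⟩ := hd
    omega
  have hm : 1 ≤ G.edges.card := by
    obtain ⟨w, hw⟩ := G.total ⟨0, hn⟩
    exact Finset.card_pos.2 ⟨_, hw⟩
  have hT1 := T.size_pos
  have hlog : 1 ≤ Real.logb 2 d := by
    rw [Real.le_logb_iff_rpow_le one_lt_two (by positivity), Real.rpow_one]
    exact_mod_cast hd2
  have hnat : t ≤ 189 * (G.edges.card * T.size) := by
    have h1 := Nat.mul_le_mul_right (T.size + 1) (sum_liftCost_le (G := G))
    have h2 : 1 ≤ G.edges.card * T.size := Nat.mul_pos hm hT1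
    have h3 : G.edges.card * 1 ≤ G.edges.card * T.size := Nat.mul_le_mul_left _ hT1
    have h4 : 92 * G.edges.card * (T.size + 1) =
      92 * (G.edges.card * T.size) + 92 * G.edges.card := by ring
    omega
  have hlogs : 1 ≤ max 1 (Real.logb 2 n) * Real.logb 2 d :=
    one_le_mul_of_one_le_of_one_le (le_max_left _ _) hlog
  calc (t : ℝ) ≤ 189 * (G.edges.card * T.size) := by exact_mod_cast hnat
    _ ≤ 189 * (G.edges.card * T.size * (max 1 (Real.logb 2 n) * Real.logb 2 d)) := by
      refine mul_le_mul_of_nonneg_left (le_mul_of_one_le_right (by positivity) hlogs) (by norm_num)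
    _ = _ := by ring
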